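/- **Theorem (Local central limit theorem).** There exists a universal constant $C>0$ such that the following holds. Let $B$ be a finite set, let $V$ be a linear subspace of $\mathbb{Q}^B$ (functions $B\to\mathbb{Q}$), let $\{\phi_a\}_{a\in A}$ be any basis of $V$ (so $|A|=\dim V$), and define $\phi:B\to\mathbb{Q}^A$ by $\phi(b)_a=\phi_a(b)$. Let $V^\perp=\{g\in\mathbb{Q}^B:\ \sum_{b\in B}f(b)g(b)=0\ \ \forall f\in V\}$. Assume that for some integers $c_2,c_3\ge 1$: 1. $V$ is spanned by the vectors $\gamma\in V\cap\mathbb{Z}^B$ with $\|\gamma\|_\infty\le c_2$; 2. $V^\perp$ is spanned by the vectors $\gamma\in V^\perp\cap\mathbb{Z}^B$ with $\|\gamma\|_1\le c_3$; 3. for all $b_1,b_2\in B$ there is a permutation $\pi$ of $B$ with $\pi(b_1)=b_2$ and $f\circ\pi\in V$ for every $f\in V$. Let $0<p<1$, let $T$ be a random subset of $B$ containing each point of $B$ independently with probability $p$, and let $X=\sum_{b\in T}\phi(b)$, with mean $\mathbb{E}[X]\in\mathbb{R}^A$ and covariance matrix $\Sigma[X]\in\mathbb{R}^{A\times A}$.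 Let $\mathcal{L}(\phi)=\{\sum_{b\in B}n_b\phi(b): n_b\in\mathbb{Z}\}$, and let $\det\mathcal{L}(\phi)$ be the Lebesgue measure of a fundamental domain of this lattice in $\mathbb{R}^A$. If $$\min(p|B|,(1-p)|B|)\ \ge\ C\,c_2\,c_3^2\,\dim(V)^6\,\bigl(\log(2c_3\dim V)\bigr)^6,$$ then for every $\lambda\in\mathcal{L}(\phi)$, $$\Pr[X=\lambda]=\frac{\det\mathcal{L}(\phi)}{(2\pi)^{\dim(V)/2}\sqrt{\det\Sigma[X]}}\left(e^{-\frac12(\lambda-\mathbb{E}[X])^t\,\Sigma[X]^{-1}(\lambda-\mathbb{E}[X])}+\delta(\lambda)\right),$$ where $$|\delta(\lambda)|\le\frac{C\,\dim(V)^3\,\bigl(\log(2c_2\dim V)\bigr)^{3/2}}{\sqrt{\min(p|B|,(1-p)|B|)}}.$$ (If $\dim V=0$, the two bounds involving $\dim V$ are read as $0$, and determinants of empty matrices and of the zero-dimensional lattice are $1$.) -/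

import Mathlib

open MeasureTheory ProbabilityTheory
open scoped Matrix ENNReal

namespace LCLT

/-- `W ⊆ ℚ^B` has a `c`-bounded integer basis in `ℓ_q`: `W` is spanned by the integer vectors lying
in `W` whose `ℓ_q` norm is at most `c`. -/
def HasBoundedIntegerBasis {B : Type*} [Fintype B] (q : ℝ≥0∞) (c : ℝ)
    (W : Submodule ℚ (B → ℚ)) : Prop :=
  Submodule.span ℚ {f : B → ℚ | f ∈ W ∧ ∃ γ : B → ℤ, (∀ b, f b = (γ b : ℚ)) ∧
    ‖WithLp.toLp q (fun b => (γ b : ℝ))‖ ≤ c} = W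

/-- The orthogonal complement of `V` in `ℚ^B` for the standard inner product. -/
def orthCompl {B : Type*} [Fintype B] (V : Submodule ℚ (B → ℚ)) : Submodule ℚ (B → ℚ) where
  carrier := {g | ∀ f ∈ V, ∑ b, f b * g b = 0}
  zero_mem' := by
    intro f _
    simp
  add_mem' := by
    intro g h hg hh f hf
    simp [mul_add, Finset.sum_add_distrib, hg f hf, hh f hf]
  smul_mem' := by
    intro c g hg f hf
    have h : ∑ b, f b * (c • g) b = c * ∑ b, f b * g b := by
      rw [Finset.mul_sum]
      refine Finset.sum_congr rfl fun b _ => ?_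
      simp only [Pi.smul_apply, smul_eq_mul]
      ring
    rw [h, hg f hf, mul_zero]

/-- A permutation `π` of `B` is a symmetry of `V` if `f ∘ π ∈ V` for all `f ∈ V`. -/
def IsSymmetry {B : Type*} (V : Submodule ℚ (B → ℚ)) (π : Equiv.Perm B) : Prop :=
  ∀ f ∈ V, f ∘ π ∈ V

/-- The map `φ : B → ℚ^A`, `φ(b)_a = φ_a(b)`, attached to a basis `(φ_a)` of `V`. -/
noncomputable def basisMap {A B : Type*} {V : Submodule ℚ (B → ℚ)} (φ : Module.Basis A ℚ V) : B → A → ℚ :=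
  fun b a => (φ a : B → ℚ) b

/-- The lattice in `ℚ^A` spanned over `ℤ` by the vectors `φ(b)`. -/
def lattice {A B : Type*} (φ : B → A → ℚ) : Submodule ℤ (A → ℚ) :=
  Submodule.span ℤ (Set.range φ)

/-- The coordinatewise inclusion `ℚ^A → ℝ^A`. -/
noncomputable def toRealVec {A : Type*} (x : A → ℚ) : A → ℝ := fun a => (x a : ℝ)

/-- The lattice spanned by the vectors `φ(b)`, viewed inside `ℝ^A`. -/
noncomputable def realLattice {A B : Type*} (φ : B → A → ℚ) : Submodule ℤ (A → ℝ) :=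
  (lattice φ).map ((Rat.castHom ℝ).toAddMonoidHom.compLeft A).toIntLinearMap

/-- The determinant of the lattice spanned by the vectors `φ(b)`: the Lebesgue measure of a
fundamental domain. -/
noncomputable def latticeDet {A B : Type*} [Fintype A] (φ : B → A → ℚ) : ℝ :=
  ZLattice.covolume (realLattice φ) (volume : Measure (A → ℝ))

/-- `T` is a random `p`-subset of `B`: every point of `B` belongs to `T` independently with
probability `p`. -/
structure IsRandomSubset {B Ω : Type*} [MeasurableSpace Ω] (P : Measure Ω) (p : ℝ)
    (T : Ω → Finset B) : Prop where
  measurableSet_mem : ∀ b, MeasurableSet {ω | b ∈ T ω}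
  prob_mem : ∀ b, P.real {ω | b ∈ T ω} = p
  indep : iIndepSet (fun b => {ω | b ∈ T ω}) P

/-- The random vector `X = ∑_{b ∈ T} φ(b)`. -/
def randomSum {A B Ω : Type*} (φ : B → A → ℚ) (T : Ω → Finset B) (ω : Ω) : A → ℚ :=
  ∑ b ∈ T ω, φ b

/-- The mean of a random vector with values in `ℚ^A`. -/
noncomputable def meanVec {A Ω : Type*} [MeasurableSpace Ω] (P : Measure Ω)
    (X : Ω → A → ℚ) : A → ℝ :=
  fun a => ∫ ω, (X ω a : ℝ) ∂P

/-- The covariance matrix of a random vector with values in `ℚ^A`. -/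
noncomputable def covMatrix {A Ω : Type*} [MeasurableSpace Ω] (P : Measure Ω)
    (X : Ω → A → ℚ) : Matrix A A ℝ :=
  Matrix.of fun a a' => cov[fun ω => (X ω a : ℝ), fun ω => (X ω a' : ℝ); P]

end LCLT

/-!
# Local central limit theorem for random subset sums with symmetries

Fix a `ℤ`-basis of the lattice generated by the vectors `φ b` and let `v b ∈ ℤ^A` be the coordinates
of `φ b` (`exists_lattice_basis`). The coordinate functions of `v` still span `V`, and the three
hypotheses become the conditions `IsAdapted` on `v` (`isAdapted_of_basis`). The covolume of the
lattice is the determinant of the change of basis (`latticeDet_eq`), so that the normalisation and the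
quadratic form in the statement agree with those of `v`. Write `d = |A|`, `N = |B|`, `q = p (1 - p)`.

By Fourier inversion the probability is the integral over the torus of the characteristic function,
whose modulus at `t` is at most `exp (-8 q ∑ b, ‖⟨t, v b⟩‖²)`, with `‖·‖` the distance to `ℤ`. If all
phases `⟨t, v b⟩` are within `1 / (2 c₃)` of integers, then those integers are annihilated by the short
relations, which span `V^⊥`, so they form an integral functional (`exists_int_of_near`). Hence the
region where all phases are less than `1 / (2 c₃)` in modulus, together with the part of the cube
where some phase is further than that from `ℤ`, is again a fundamental domain of `ℤ^A`
(`isAddFundamentalDomain`).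

*Far frequencies.* Let `J` be a maximal subset of `B` whose subset sums of the short vectors are
distinct. By counting, `|J| = O(d log (2 c₂ d))`, and by maximality every `v b` is a combination of
the `v j`, `j ∈ J`, with coefficients `0, ±1` (`exists_dissociated`). The same holds for every
translate of `J` by a symmetry, and averaging over the symmetries shows that one phase at distance
`1 / (2 c₃)` from the integers forces `∑ b, ‖⟨t, v b⟩‖² ≥ N / (4 c₃² |J|²)`
(`card_mul_sq_sub_round_le`). The resulting bound `norm_integral_far_le` is absolute; it becomes
relative to the size of the main term since the short integer vectors in `V` bound the determinant
of the Gram matrix by `(c₂² N)^d` (`det_gram_le`).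

*Small phases.* By transitivity all points have the same leverage, so
`⟨t, v b⟩² ≤ (d / N) ∑ b', ⟨t, v b'⟩²` (`card_mul_sq_lin_le`). Where the quadratic form is small, all
phases are thus at most `1 / (8 d c₃)`, and a third order Taylor expansion of each factor shows that
the integrand differs from the Fourier transform of the Gaussian by a cubic error, of relative size
`O(d² / √(q N))` after integration (`cubic_error_le`). Elsewhere both functions are bounded by
Gaussian tails (`norm_integral_small_sub_le`).

The three errors are collected in `abs_pointProb_sub_le` and compared with the claimed bound in
`total_error_le`, where the size condition on `N` makes both exponentially small terms negligible.
-/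

namespace LCLT

/-! ### Characteristic functions of Bernoulli variables -/

/-- The characteristic function `x ↦ 1 - p + p e^{2πix}` of a Bernoulli variable of parameter `p`. -/
noncomputable def bernChar (p x : ℝ) : ℂ :=
  (1 - p) + p * Complex.exp (2 * Real.pi * Complex.I * x)

lemma norm_bernChar_sq (p x : ℝ) :
    ‖bernChar p x‖ ^ 2 = 1 - 4 * (p * (1 - p)) * Real.sin (Real.pi * x) ^ 2 := by
  have h : bernChar p x = ((1 - p + p * Real.cos (2 * Real.pi * x) : ℝ) : ℂ)
      + ((p * Real.sin (2 * Real.pi * x) : ℝ) : ℂ) * Complex.I := by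
    have : (2 * Real.pi * Complex.I * x : ℂ) = ((2 * Real.pi * x : ℝ) : ℂ) * Complex.I := by
      push_cast; ring
    rw [bernChar, this, Complex.exp_mul_I]
    push_cast
    ring
  rw [h, ← Complex.normSq_eq_norm_sq, Complex.normSq_add_mul_I]
  have h1 : 2 * Real.pi * x = 2 * (Real.pi * x) := by ring
  rw [h1, Real.cos_two_mul, Real.sin_two_mul]
  have h2 := Real.sin_sq_add_cos_sq (Real.pi * x)
  have h3 : Real.cos (Real.pi * x) ^ 2 = 1 - Real.sin (Real.pi * x) ^ 2 := by linarith
  have h4 : (p * (2 * Real.sin (Real.pi * x) * Real.cos (Real.pi * x))) ^ 2 =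
    4 * p ^ 2 * Real.sin (Real.pi * x) ^ 2 * Real.cos (Real.pi * x) ^ 2 := by ring
  rw [h4, h3]
  ring

lemma norm_bernChar_le_exp_sin (p x : ℝ) :
    ‖bernChar p x‖ ≤ Real.exp (-(2 * (p * (1 - p)) * Real.sin (Real.pi * x) ^ 2)) := by
  refine le_of_sq_le_sq ?_ (Real.exp_pos _).le
  rw [norm_bernChar_sq, ← Real.exp_nat_mul]
  have := Real.add_one_le_exp (-(4 * (p * (1 - p)) * Real.sin (Real.pi * x) ^ 2))
  refine le_trans (by linarith) (this.trans (le_of_eq ?_))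
  congr 1
  push_cast
  ring

lemma four_mul_sq_le_sin_sq {x : ℝ} (hx : |x| ≤ 1 / 2) :
    4 * x ^ 2 ≤ Real.sin (Real.pi * x) ^ 2 := by
  wlog h : 0 ≤ x generalizing x
  · have := this (x := -x) (by rwa [abs_neg]) (by linarith)
    simpa using this
  rw [abs_of_nonneg h] at hx
  have h1 := Real.mul_le_sin (x := Real.pi * x) (by positivity) (by nlinarith [Real.pi_pos])
  have h2 : 2 / Real.pi * (Real.pi * x) = 2 * x := by field_simp
  rw [h2] at h1
  nlinarith

lemma norm_bernChar_le_exp_round {p : ℝ} (h0 : 0 ≤ p) (h1 : p ≤ 1) (x : ℝ) :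
    ‖bernChar p x‖ ≤ Real.exp (-(8 * (p * (1 - p)) * (x - round x) ^ 2)) := by
  refine (norm_bernChar_le_exp_sin p x).trans (Real.exp_le_exp.2 ?_)
  have h := four_mul_sq_le_sin_sq (abs_sub_round x)
  have h2 : Real.sin (Real.pi * (x - round x)) ^ 2 = Real.sin (Real.pi * x) ^ 2 := by
    rw [mul_sub, mul_comm Real.pi (round x : ℝ), Real.sin_sub_int_mul_pi]
    rcases Int.even_or_odd (round x) with h | h <;> simp [h.neg_one_zpow]
  rw [h2] at h
  have hq : 0 ≤ p * (1 - p) := mul_nonneg h0 (by linarith)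
  nlinarith [mul_le_mul_of_nonneg_left h hq]

lemma sq_sub_le_sin_sq {y : ℝ} (hy : |y| ≤ 1) : y ^ 2 - y ^ 4 / 3 ≤ Real.sin y ^ 2 := by
  wlog h : 0 < y generalizing y
  · rcases eq_or_lt_of_le (not_lt.1 h) with h0 | h0
    · simp [h0]
    · have := this (y := -y) (by rwa [abs_neg]) (by linarith)
      simpa [Even.neg_pow (by decide : Even 4)] using this
  rw [abs_of_pos h] at hy
  have h1 := Real.sin_gt_sub_cube h
  have h3 : y ^ 3 ≤ y := by nlinarith [mul_nonneg h.le (by nlinarith : (0:ℝ) ≤ 1 - y ^ 2)]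
  have h2 : 0 ≤ y - y ^ 3 / 6 := by linarith
  have h4 : (y - y ^ 3 / 6) ^ 2 ≤ Real.sin y ^ 2 := by gcongr
  nlinarith [sq_nonneg (y ^ 3)]

lemma norm_bernChar_le_exp_of_abs_le {p x ε η : ℝ} (h0 : 0 ≤ p) (h1 : p ≤ 1)
    (hx : |x| ≤ ε) (hε : ε ≤ 1 / 8) (hη : Real.pi ^ 2 * ε ^ 2 / 3 ≤ η) :
    ‖bernChar p x‖ ≤ Real.exp (-(2 * Real.pi ^ 2 * (1 - η) * (p * (1 - p)) * x ^ 2)) := by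
  refine (norm_bernChar_le_exp_sin p x).trans (Real.exp_le_exp.2 ?_)
  have hx2 : |Real.pi * x| ≤ 1 := by
    rw [abs_mul, abs_of_pos Real.pi_pos]
    nlinarith [Real.pi_pos, Real.pi_lt_d2, abs_nonneg x]
  have h := sq_sub_le_sin_sq hx2
  have hq : 0 ≤ p * (1 - p) := mul_nonneg h0 (by linarith)
  have hxe : x ^ 2 ≤ ε ^ 2 := by rw [← sq_abs x]; gcongr
  have h3 : Real.pi ^ 2 * x ^ 2 * (1 - η) ≤ Real.sin (Real.pi * x) ^ 2 := by
    refine le_trans ?_ h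
    have : Real.pi ^ 2 * x ^ 2 / 3 ≤ η := le_trans (by gcongr) hη
    nlinarith [mul_le_mul_of_nonneg_left this (by positivity : 0 ≤ Real.pi ^ 2 * x ^ 2)]
  nlinarith [mul_le_mul_of_nonneg_left h3 hq]

lemma norm_exp_mul_I_sub_le {y : ℝ} (hy : |y| ≤ 1) :
    ‖Complex.exp (y * Complex.I) - (1 + y * Complex.I - y ^ 2 / 2)‖ ≤ 2 / 9 * |y| ^ 3 := by
  have n1 : ‖(y * Complex.I : ℂ)‖ = |y| := by
    rw [norm_mul, Complex.norm_I, mul_one, Complex.norm_real, Real.norm_eq_abs]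
  have b1 := Complex.exp_bound (x := y * Complex.I) (by rwa [n1]) (n := 3) (by norm_num)
  rw [n1] at b1
  refine le_trans (le_of_eq ?_) (b1.trans (le_of_eq ?_))
  · congr 2
    simp only [Finset.sum_range_succ, Finset.sum_range_zero, Nat.factorial]
    push_cast
    linear_combination (-(y : ℂ) ^ 2 / 2) * Complex.I_sq
  · simp only [Nat.factorial]
    push_cast
    ring

lemma abs_exp_neg_sub_le {w : ℝ} (h0 : 0 ≤ w) (h1 : w ≤ 1) :
    |Real.exp (-w) - (1 - w)| ≤ w ^ 2 := by
  have b := Real.exp_bound (x := -w) (by rwa [abs_neg, abs_of_nonneg h0]) (n := 2) (by norm_num)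
  refine le_trans (le_of_eq ?_) (b.trans ?_)
  · congr 1
    simp only [Finset.sum_range_succ, Finset.sum_range_zero, Nat.factorial]
    push_cast
    ring
  · rw [abs_neg, abs_of_nonneg h0]
    simp only [Nat.factorial]
    push_cast
    nlinarith [sq_nonneg w]

lemma norm_bernChar_mul_exp_sub_le {p u : ℝ} (h0 : 0 ≤ p) (h1 : p ≤ 1) (hu : |u| ≤ 4 / 5) :
    ‖(1 - p) * Complex.exp ((-(p * u) : ℝ) * Complex.I)
        + p * Complex.exp (((1 - p) * u : ℝ) * Complex.I)
      - (Real.exp (-(p * (1 - p) * u ^ 2 / 2)) : ℂ)‖ ≤ 1 / 3 * (p * (1 - p) * |u| ^ 3) := by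
  have hp1 : 0 ≤ 1 - p := by linarith
  obtain ⟨q, hqdef⟩ : ∃ q, q = p * (1 - p) := ⟨_, rfl⟩
  have hq : 0 ≤ q := hqdef ▸ mul_nonneg h0 hp1
  have hq4 : q ≤ 1 / 4 := by rw [hqdef]; nlinarith [sq_nonneg (p - 1 / 2)]
  have hu0 := abs_nonneg u
  have hu2 : u ^ 2 ≤ 1 := by rw [← sq_abs]; nlinarith
  have a1 : |(-(p * u))| = p * |u| := by rw [abs_neg, abs_mul, abs_of_nonneg h0]
  have a2 : |(1 - p) * u| = (1 - p) * |u| := by rw [abs_mul, abs_of_nonneg hp1]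
  have b1 := norm_exp_mul_I_sub_le (y := -(p * u)) (by rw [a1]; nlinarith)
  have b2 := norm_exp_mul_I_sub_le (y := (1 - p) * u) (by rw [a2]; nlinarith)
  have b3 := abs_exp_neg_sub_le (w := q * u ^ 2 / 2) (by positivity) (by nlinarith)
  rw [a1] at b1
  rw [a2] at b2
  -- The Taylor polynomials combine to `1 - q u² / 2`: the linear terms cancel by the centring.
  have key : ∀ E₁ E₂ E₃ : ℂ, (1 - p) * E₁ + p * E₂ - E₃
      = (1 - p : ℝ) * (E₁ - (1 + (-(p * u) : ℝ) * Complex.I - ((-(p * u) : ℝ) : ℂ) ^ 2 / 2))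
        + (p : ℂ) * (E₂ - (1 + ((1 - p) * u : ℝ) * Complex.I - (((1 - p) * u : ℝ) : ℂ) ^ 2 / 2))
        - (E₃ - ((1 - q * u ^ 2 / 2 : ℝ) : ℂ)) := by
    intro E₁ E₂ E₃
    rw [hqdef]
    push_cast
    ring
  rw [← hqdef, key]
  refine (norm_sub_le _ _).trans ?_
  refine (add_le_add_left (norm_add_le _ _) _).trans ?_
  rw [norm_mul, norm_mul, Complex.norm_real, Complex.norm_real, Real.norm_eq_abs,
      Real.norm_eq_abs, abs_of_nonneg h0, abs_of_nonneg hp1, ← Complex.ofReal_sub,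
      Complex.norm_real, Real.norm_eq_abs]
  have hx3 : 0 ≤ q * |u| ^ 3 := by positivity
  have hD' : (q * u ^ 2 / 2) ^ 2 ≤ 1 / 20 * (q * |u| ^ 3) := by
    have : (q * u ^ 2 / 2) ^ 2 = q * |u| ^ 3 * (q * |u| / 4) := by
      rw [← sq_abs u]; ring
    rw [this]
    have h5 : q * |u| / 4 ≤ 1 / 20 := by nlinarith
    nlinarith [mul_le_mul_of_nonneg_left h5 hx3]
  have c1 := mul_le_mul_of_nonneg_left b1 hp1
  have c2 := mul_le_mul_of_nonneg_left b2 h0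
  have c3 : (1 - p) * (2 / 9 * (p * |u|) ^ 3) + p * (2 / 9 * ((1 - p) * |u|) ^ 3)
      ≤ 2 / 9 * (q * |u| ^ 3) := by
    have : (1 - p) * (2 / 9 * (p * |u|) ^ 3) + p * (2 / 9 * ((1 - p) * |u|) ^ 3)
      = 2 / 9 * (q * |u| ^ 3) * (p ^ 2 + (1 - p) ^ 2) := by rw [hqdef]; ring
    rw [this]
    have h6 : p ^ 2 + (1 - p) ^ 2 ≤ 1 := by nlinarith
    exact mul_le_of_le_one_right (by positivity) h6
  linarith

/-- Third order Taylor expansion: after centring, a Bernoulli characteristic function agrees with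
that of the Gaussian of the same variance up to a cubic error proportional to the variance. -/
lemma norm_bernChar_sub_gaussian_le {p x : ℝ} (h0 : 0 ≤ p) (h1 : p ≤ 1) (hx : |x| ≤ 1 / 8) :
    ‖bernChar p x * Complex.exp (-(2 * Real.pi * Complex.I * (p * x)))
      - (Real.exp (-(2 * Real.pi ^ 2 * (p * (1 - p)) * x ^ 2)) : ℂ)‖
      ≤ 100 * (p * (1 - p)) * |x| ^ 3 := by
  have hq : 0 ≤ p * (1 - p) := mul_nonneg h0 (by linarith)
  have hu : |2 * Real.pi * x| = 2 * Real.pi * |x| := by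
    rw [abs_mul, abs_of_pos (by positivity : 0 < 2 * Real.pi)]
  have hu1 : |2 * Real.pi * x| ≤ 4 / 5 := by
    rw [hu]
    nlinarith [Real.pi_pos, Real.pi_lt_d2, abs_nonneg x]
  have b := norm_bernChar_mul_exp_sub_le h0 h1 hu1
  have e1 : bernChar p x * Complex.exp (-(2 * Real.pi * Complex.I * (p * x)))
      = (1 - p) * Complex.exp ((-(p * (2 * Real.pi * x)) : ℝ) * Complex.I)
        + p * Complex.exp (((1 - p) * (2 * Real.pi * x) : ℝ) * Complex.I) := by
    rw [bernChar, add_mul, mul_assoc (p : ℂ), ← Complex.exp_add]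
    congr 3 <;> push_cast <;> ring
  have e3 : 2 * Real.pi ^ 2 * (p * (1 - p)) * x ^ 2 = p * (1 - p) * (2 * Real.pi * x) ^ 2 / 2 := by
    ring
  rw [e1, e3]
  refine b.trans ?_
  have hpi3 : Real.pi ^ 3 ≤ 3.15 ^ 3 := by
    gcongr; exact Real.pi_lt_d2.le
  have hx3 : 0 ≤ p * (1 - p) * |x| ^ 3 := by positivity
  rw [hu]
  nlinarith [mul_le_mul_of_nonneg_left hpi3 hx3]

/-- Telescoping estimate for a difference of products with a common majorant of the factors. -/
lemma norm_prod_sub_prod_le {ι : Type*} (s : Finset ι) (a h : ι → ℂ) (m : ι → ℝ)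
    (hm : ∀ i ∈ s, 0 < m i) (ha : ∀ i ∈ s, ‖a i‖ ≤ m i) (hh : ∀ i ∈ s, ‖h i‖ ≤ m i) :
    ‖∏ i ∈ s, a i - ∏ i ∈ s, h i‖ ≤ (∏ i ∈ s, m i) * ∑ i ∈ s, ‖a i - h i‖ / m i := by
  classical
  induction s using Finset.induction_on with
  | empty => simp
  | insert i s hi ih =>
    rw [Finset.prod_insert hi, Finset.prod_insert hi, Finset.prod_insert hi, Finset.sum_insert hi]
    have ih' := ih (fun j hj => hm j (Finset.mem_insert_of_mem hj))
      (fun j hj => ha j (Finset.mem_insert_of_mem hj)) (fun j hj => hh j (Finset.mem_insert_of_mem hj))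
    have hmi := hm i (Finset.mem_insert_self i s)
    have hai := ha i (Finset.mem_insert_self i s)
    have hH : ‖∏ j ∈ s, h j‖ ≤ ∏ j ∈ s, m j := by
      rw [norm_prod]
      exact Finset.prod_le_prod (fun _ _ => norm_nonneg _)
        (fun j hj => hh j (Finset.mem_insert_of_mem hj))
    have e : a i * ∏ j ∈ s, a j - h i * ∏ j ∈ s, h j
      = a i * (∏ j ∈ s, a j - ∏ j ∈ s, h j) + (a i - h i) * ∏ j ∈ s, h j := by ring
    rw [e]
    refine (norm_add_le _ _).trans ?_
    rw [norm_mul, norm_mul]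
    have e2 : (m i * ∏ j ∈ s, m j) * (‖a i - h i‖ / m i + ∑ j ∈ s, ‖a j - h j‖ / m j)
      = m i * ((∏ j ∈ s, m j) * ∑ j ∈ s, ‖a j - h j‖ / m j) + ‖a i - h i‖ * ∏ j ∈ s, m j := by
      field_simp
      ring
    rw [e2]
    exact add_le_add (mul_le_mul hai ih' (norm_nonneg _) hmi.le)
      (mul_le_mul_of_nonneg_left hH (norm_nonneg _))

/-- Comparison of the centred characteristic function of a sum of independent Bernoulli variables
with its Gaussian approximation, at frequencies where all phases `x b` are small. -/
lemma norm_prod_bernChar_sub_gaussian_le {B : Type*} [Fintype B] {p ε η : ℝ} (h0 : 0 ≤ p)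
    (h1 : p ≤ 1) (hε : ε ≤ 1 / 8) (hη : Real.pi ^ 2 * ε ^ 2 / 3 ≤ η) (hη1 : η ≤ 1)
    (x : B → ℝ) (hx : ∀ b, |x b| ≤ ε) :
    ‖∏ b, bernChar p (x b) * Complex.exp (-(2 * Real.pi * Complex.I * (p * x b)))
      - (Real.exp (-(2 * Real.pi ^ 2 * (p * (1 - p)) * ∑ b, x b ^ 2)) : ℂ)‖
      ≤ 200 * (p * (1 - p)) * (∑ b, |x b| ^ 3) *
        Real.exp (-(2 * Real.pi ^ 2 * (1 - η) * (p * (1 - p)) * ∑ b, x b ^ 2)) := by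
  set q : ℝ := p * (1 - p) with hqdef
  have hq : 0 ≤ q := mul_nonneg h0 (by linarith)
  have hq4 : q ≤ 1 / 4 := by rw [hqdef]; nlinarith [sq_nonneg (p - 1 / 2)]
  have hη0 : 0 ≤ η := le_trans (by positivity) hη
  set κ : ℝ := 2 * Real.pi ^ 2 * (1 - η) * q with hκ
  have hκ0 : 0 ≤ κ := by have : 0 ≤ 1 - η := by linarith
                         positivity
  have hκ5 : κ ≤ 5 := by
    have h2 : Real.pi ^ 2 ≤ 10 := by nlinarith [Real.pi_pos, Real.pi_lt_d2]
    have : 2 * Real.pi ^ 2 * (1 - η) * q ≤ 2 * 10 * 1 * (1 / 4) := by gcongr; linarith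
    linarith
  have e1 : (Real.exp (-(2 * Real.pi ^ 2 * q * ∑ b, x b ^ 2)) : ℂ)
      = ∏ b, (Real.exp (-(2 * Real.pi ^ 2 * q * x b ^ 2)) : ℂ) := by
    rw [← Complex.ofReal_prod, ← Real.exp_sum, Finset.mul_sum, Finset.sum_neg_distrib]
  rw [e1]
  -- Both factors are majorised by a slightly wider Gaussian, so that the telescoping estimate keeps
  -- the full Gaussian decay.
  refine (norm_prod_sub_prod_le _ _ _ (fun b => Real.exp (-(κ * x b ^ 2))) (fun _ _ => Real.exp_pos _)
    (fun b _ => ?_) (fun b _ => ?_)).trans ?_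
  · rw [norm_mul]
    have : ‖Complex.exp (-(2 * Real.pi * Complex.I * (p * x b)))‖ = 1 := by
      have h : (-(2 * Real.pi * Complex.I * (p * x b)) : ℂ)
        = ((-(2 * Real.pi * (p * x b)) : ℝ) : ℂ) * Complex.I := by push_cast; ring
      rw [h, Complex.norm_exp_ofReal_mul_I]
    rw [this, mul_one]
    exact norm_bernChar_le_exp_of_abs_le h0 h1 (hx b) hε hη
  · rw [Complex.norm_real, Real.norm_eq_abs, abs_of_pos (Real.exp_pos _)]
    refine Real.exp_le_exp.2 (neg_le_neg ?_)
    rw [hκ]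
    have : 2 * Real.pi ^ 2 * (1 - η) * q ≤ 2 * Real.pi ^ 2 * 1 * q := by gcongr; linarith
    nlinarith [mul_le_mul_of_nonneg_right this (sq_nonneg (x b))]
  · rw [← Real.exp_sum, Finset.sum_neg_distrib, ← Finset.mul_sum, mul_comm]
    refine mul_le_mul_of_nonneg_right ?_ (Real.exp_pos _).le
    rw [Finset.mul_sum]
    refine Finset.sum_le_sum fun b _ => ?_
    have hb := norm_bernChar_sub_gaussian_le h0 h1 ((hx b).trans hε)
    rw [Real.exp_neg (κ * x b ^ 2), div_inv_eq_mul]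
    have hs : x b ^ 2 ≤ 1 / 64 := by
      rw [← sq_abs]
      nlinarith [(hx b).trans hε, abs_nonneg (x b)]
    have h2 : Real.exp (κ * x b ^ 2) ≤ 2 := by
      have h3 : κ * x b ^ 2 ≤ 1 / 2 := by nlinarith [sq_nonneg (x b)]
      have h4 : Real.exp (κ * x b ^ 2) ^ 2 ≤ 2 ^ 2 := by
        rw [← Real.exp_nat_mul]
        have := Real.exp_one_lt_d9
        refine le_trans ((Real.exp_le_exp (y := 1)).2 ?_) (by linarith)
        push_cast; linarith
      exact le_of_sq_le_sq h4 (by norm_num)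
    calc _ ≤ (100 * q * |x b| ^ 3) * 2 := by
          refine mul_le_mul hb h2 (Real.exp_pos _).le (by positivity)
      _ = _ := by ring

end LCLT

namespace LCLT

/-! ### Vector systems generating `ℤ^A` -/

variable {A B : Type*} [Fintype A]

/-- The function `b ↦ ⟨t, v b⟩` on `B`. As `t` varies these functions fill the real span of the
coordinate functions of `v`. -/
def lin (v : B → A → ℤ) (t : A → ℝ) (b : B) : ℝ := ∑ a, t a * v b a

lemma lin_add (v : B → A → ℤ) (s t : A → ℝ) (b : B) : lin v (s + t) b = lin v s b + lin v t b := by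
  simp [lin, add_mul, Finset.sum_add_distrib]

lemma lin_sub (v : B → A → ℤ) (s t : A → ℝ) (b : B) : lin v (s - t) b = lin v s b - lin v t b := by
  simp [lin, sub_mul, Finset.sum_sub_distrib]

lemma lin_smul (v : B → A → ℤ) (c : ℝ) (t : A → ℝ) (b : B) :
    lin v (c • t) b = c * lin v t b := by
  simp [lin, Finset.mul_sum, mul_assoc]

lemma lin_intCast (v : B → A → ℤ) (s : A → ℤ) (b : B) :
    lin v (fun a => (s a : ℝ)) b = ((∑ a, s a * v b a : ℤ) : ℝ) := by
  simp [lin]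

lemma continuous_lin (v : B → A → ℤ) (b : B) : Continuous fun t => lin v t b := by
  unfold lin
  fun_prop

variable [Fintype B]

/-- The hypotheses of the local limit theorem in coordinates adapted to the lattice: the vectors
`v b` generate `ℤ^A`, integer functions `γ i`
bounded by `c₂` span the same rational space as the coordinate functions of `v`, an integer function annihilated by the integer relations among the `v b` of
`ℓ¹`-norm at most `c₃` is of the form `⟨s, v ·⟩` with `s` integral, and the permutations of `B`
preserving the space of functions `⟨t, v ·⟩` act transitively. -/
structure IsAdapted [DecidableEq A] (v : B → A → ℤ) (c₂ c₃ : ℕ) : Prop where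
  gen : ∀ a, ∃ k : B → ℤ, ∀ a', ∑ b, k b * v b a' = if a = a' then 1 else 0
  bounded : ∃ (γ : A → B → ℤ) (M : Matrix A A ℤ), M.det ≠ 0 ∧ (∀ i b, |γ i b| ≤ c₂) ∧
    ∀ i b, γ i b = ∑ a, M i a * v b a
  dual : ∀ n : B → ℤ, (∀ γ : B → ℤ, (∀ a, ∑ b, γ b * v b a = 0) → ∑ b, |γ b| ≤ c₃ →
    ∑ b, γ b * n b = 0) → ∃ s : A → ℤ, ∀ b, n b = ∑ a, s a * v b a
  symm : ∀ b₁ b₂, ∃ π : Equiv.Perm B, π b₁ = b₂ ∧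
    ∀ t : A → ℝ, ∃ t' : A → ℝ, ∀ b, lin v t (π b) = lin v t' b

/-! ### Dissociated generating sets -/

/-- A maximal set with pairwise distinct subset sums represents every vector of the family as a
combination with coefficients `0, ±1`; it is small because its subset sums lie in a box. -/
lemma exists_dissociated (w : B → A → ℤ) (c : ℕ) (hw : ∀ b a, |w b a| ≤ c) :
    ∃ J : Finset B, 2 ^ J.card ≤ (2 * J.card * c + 1) ^ Fintype.card A ∧
      ∀ b, ∃ n : B → ℤ, (∀ j, |n j| ≤ 1) ∧ ∀ a, w b a = ∑ j ∈ J, n j * w j a := by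
  classical
  let P : Finset B → Prop := fun J =>
    Set.InjOn (fun S : Finset B => ∑ j ∈ S, w j) (J.powerset : Set (Finset B))
  obtain ⟨J, hJ, hmax⟩ := Finset.exists_max_image (Finset.univ.filter P) Finset.card
    ⟨∅, Finset.mem_filter.2 ⟨Finset.mem_univ _, fun S hS T hT _ => by
      rw [Finset.mem_coe, Finset.mem_powerset, Finset.subset_empty] at hS hT
      rw [hS, hT]⟩⟩
  have hJP : P J := (Finset.mem_filter.1 hJ).2
  refine ⟨J, ?_, fun b => ?_⟩
  · have himg : (J.powerset.image fun S : Finset B => ∑ j ∈ S, w j) ⊆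
        Fintype.piFinset fun _ : A => Finset.Icc (-((J.card * c : ℕ) : ℤ)) ((J.card * c : ℕ) : ℤ) := by
      intro x hx
      obtain ⟨S, hS, rfl⟩ := Finset.mem_image.1 hx
      rw [Fintype.mem_piFinset]
      intro a
      rw [Finset.mem_Icc, ← abs_le, Finset.sum_apply]
      calc |∑ j ∈ S, w j a| ≤ ∑ j ∈ S, |w j a| := Finset.abs_sum_le_sum_abs _ _
        _ ≤ ∑ _j ∈ S, (c : ℤ) := Finset.sum_le_sum fun j _ => hw j a
        _ = S.card * c := by simp
        _ ≤ ((J.card * c : ℕ) : ℤ) := by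
          push_cast
          have := Finset.card_le_card (Finset.mem_powerset.1 hS)
          gcongr
    have h := Finset.card_le_card himg
    rw [Finset.card_image_of_injOn hJP, Finset.card_powerset, Fintype.card_piFinset] at h
    simp only [Int.card_Icc, Finset.prod_const, Finset.card_univ] at h
    refine h.trans (le_of_eq ?_)
    congr 1
    have : ((J.card * c : ℕ) : ℤ) + 1 - -((J.card * c : ℕ) : ℤ) = ((2 * J.card * c + 1 : ℕ) : ℤ) := by
      push_cast; ring
    rw [this, Int.toNat_natCast]
  · by_cases hb : b ∈ J
    · refine ⟨Pi.single b 1, fun j => ?_, fun a => ?_⟩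
      · by_cases h : j = b
        · subst h; simp
        · simp [h]
      · simp [Pi.single_apply, hb]
    · -- By maximality, two subsets of `insert b J` have equal sums; they differ at `b` since the subset
      -- sums of `J` are distinct, and their difference expresses `w b` through `J`.
      have hnP : ¬ P (insert b J) := by
        intro h
        have := hmax (insert b J) (by simpa using h)
        rw [Finset.card_insert_of_notMem hb] at this
        omega
      simp only [P, Set.InjOn, not_forall] at hnP
      obtain ⟨S₁, h₁, S₂, h₂, hs, hne⟩ := hnP
      rw [Finset.mem_coe, Finset.mem_powerset] at h₁ h₂
      -- The signed indicator of the two coinciding subset sums.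
      let m : B → ℤ := fun j => (if j ∈ S₁ then 1 else 0) - (if j ∈ S₂ then 1 else 0)
      have hm : ∀ j, |m j| ≤ 1 := by
        intro j; simp only [m]; split_ifs <;> simp
      have hsum : ∀ a, m b * w b a + ∑ j ∈ J, m j * w j a = 0 := by
        intro a
        rw [← Finset.sum_insert (f := fun j => m j * w j a) hb]
        have h3 := congrFun hs a
        simp only [Finset.sum_apply] at h3
        simp only [m, sub_mul, ite_mul, one_mul, zero_mul, Finset.sum_sub_distrib,
          Finset.sum_ite_mem]
        rw [Finset.inter_eq_right.2 h₁, Finset.inter_eq_right.2 h₂, h3, sub_self]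
      have herase : ∀ S : Finset B, S ⊆ insert b J → S.erase b ∈ J.powerset := fun S hS => by
        rw [Finset.mem_powerset]
        intro x hx
        rcases Finset.mem_insert.1 (hS (Finset.mem_of_mem_erase hx)) with h | h
        · exact absurd h (Finset.ne_of_mem_erase hx)
        · exact h
      by_cases hb1 : b ∈ S₁ <;> by_cases hb2 : b ∈ S₂
      · exfalso
        apply hne
        have := hJP (herase S₁ h₁) (herase S₂ h₂) (by
          have e1 := Finset.add_sum_erase S₁ w hb1
          have e2 := Finset.add_sum_erase S₂ w hb2
          simp only at hs ⊢
          rw [← e1, ← e2] at hs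
          exact add_left_cancel hs)
        rw [← Finset.insert_erase hb1, ← Finset.insert_erase hb2, this]
      · refine ⟨fun j => -m j, fun j => by rw [abs_neg]; exact hm j, fun a => ?_⟩
        have := hsum a
        have hmb : m b = 1 := by simp [m, hb1, hb2]
        rw [hmb] at this
        simp only [neg_mul, Finset.sum_neg_distrib]
        linarith
      · refine ⟨m, hm, fun a => ?_⟩
        have := hsum a
        have hmb : m b = -1 := by simp [m, hb1, hb2]
        rw [hmb] at this
        linarith
      · exfalso
        apply hne
        have e1 := Finset.erase_eq_of_notMem hb1
        have e2 := Finset.erase_eq_of_notMem hb2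
        have f1 := herase S₁ h₁
        have f2 := herase S₂ h₂
        rw [e1] at f1
        rw [e2] at f2
        exact hJP f1 f2 hs

/-- The size of a dissociated set in a box of side `O(K c)` in dimension `d` is `O(d log (2 c d))`. -/
lemma card_le_of_two_pow_le {K c d : ℕ} (hc : 1 ≤ c) (hd : 1 ≤ d)
    (h : 2 ^ K ≤ (2 * K * c + 1) ^ d) : (K : ℝ) ≤ 6 * d * Real.log (2 * c * d) := by
  have hc' : (1 : ℝ) ≤ c := by exact_mod_cast hc
  have hd' : (1 : ℝ) ≤ d := by exact_mod_cast hd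
  have hcd : (1 : ℝ) ≤ c * d := one_le_mul_of_one_le_of_one_le hc' hd'
  have hl : Real.log 2 ≤ Real.log (2 * c * d) :=
    Real.log_le_log (by norm_num) (by nlinarith)
  have hl2 := Real.log_two_gt_d9
  have hl2' := Real.log_two_lt_d9
  rcases Nat.eq_zero_or_pos K with rfl | hK
  · simp only [Nat.cast_zero]
    have : 0 < Real.log (2 * c * d) := by linarith
    positivity
  have hK' : (1 : ℝ) ≤ K := by exact_mod_cast hK
  have hR : (2 : ℝ) ^ K ≤ (2 * K * c + 1) ^ d := by exact_mod_cast h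
  have hlog := Real.log_le_log (by positivity) hR
  rw [Real.log_pow, Real.log_pow] at hlog
  set u : ℝ := K / d with hu
  have hu0 : 0 < u := by positivity
  have hKu : (K : ℝ) = u * d := by rw [hu]; field_simp
  have hKc : (1 : ℝ) ≤ K * c := one_le_mul_of_one_le_of_one_le hK' hc'
  have h1 : Real.log (2 * K * c + 1) ≤ Real.log (2 * c * d) + Real.log 2 + Real.log u := by
    rw [← Real.log_mul (by positivity) (by norm_num), ← Real.log_mul (by positivity) hu0.ne']
    refine Real.log_le_log (by positivity) ?_
    have : 2 * c * d * 2 * u = 4 * (K * c) := by rw [hKu]; ring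
    rw [this]
    linarith
  have h2 : Real.log u ≤ u / 4 + 2 * Real.log 2 - 1 := by
    have h3 := Real.log_le_sub_one_of_pos (x := u / 4) (by positivity)
    rw [Real.log_div hu0.ne' (by norm_num), show (4 : ℝ) = 2 ^ 2 by norm_num, Real.log_pow] at h3
    push_cast at h3
    linarith
  have h4 : u * Real.log 2 ≤ Real.log (2 * K * c + 1) := by
    rw [hKu] at hlog
    have : (d : ℝ) * (u * Real.log 2) ≤ d * Real.log (2 * K * c + 1) := by rw [hKu]; linarith
    exact le_of_mul_le_mul_left this (by linarith)
  have h5 : u ≤ 6 * Real.log (2 * c * d) := by nlinarith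
  rw [hKu]
  nlinarith

/-! ### Averaging over symmetries -/

/-- Averaging a function along the orbit of a point under a transitive group gives its mean. -/
lemma card_mul_sum_perm_apply [DecidableEq B] (G : Finset (Equiv.Perm B))
    (hmul : ∀ π ∈ G, ∀ σ ∈ G, π * σ ∈ G) (htrans : ∀ b₁ b₂, ∃ π ∈ G, π b₁ = b₂) (h : B → ℝ) (j : B) :
    Fintype.card B * ∑ π ∈ G, h (π j) = G.card * ∑ b, h b := by
  have hj : ∀ i, ∑ π ∈ G, h (π i) = ∑ π ∈ G, h (π j) := by
    intro i
    obtain ⟨σ, hσ, hσj⟩ := htrans j i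
    have himg : G.image (· * σ) = G := by
      apply Finset.eq_of_subset_of_card_le
      · intro x hx
        obtain ⟨π, hπ, rfl⟩ := Finset.mem_image.1 hx
        exact hmul π hπ σ hσ
      · rw [Finset.card_image_of_injective _ (mul_left_injective σ)]
    conv_rhs => rw [← himg]
    rw [Finset.sum_image fun _ _ _ _ h => mul_left_injective σ h]
    simp [hσj]
  calc (Fintype.card B : ℝ) * ∑ π ∈ G, h (π j) = ∑ i : B, ∑ π ∈ G, h (π i) := by
        simp [hj]
    _ = ∑ π ∈ G, ∑ i, h (π i) := Finset.sum_comm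
    _ = ∑ π ∈ G, ∑ i, h i := Finset.sum_congr rfl fun π _ => Equiv.sum_comp π h
    _ = _ := by simp

lemma abs_sub_round_sum_le {ι : Type*} (s : Finset ι) (n : ι → ℤ) (hn : ∀ i, |n i| ≤ 1) (y : ι → ℝ) :
    |(∑ i ∈ s, n i * y i) - round (∑ i ∈ s, n i * y i)| ≤ ∑ i ∈ s, |y i - round (y i)| := by
  refine (round_le _ (∑ i ∈ s, n i * round (y i))).trans ?_
  push_cast
  rw [← Finset.sum_sub_distrib]
  refine (Finset.abs_sum_le_sum_abs _ _).trans (Finset.sum_le_sum fun i _ => ?_)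
  rw [← mul_sub, abs_mul]
  refine mul_le_of_le_one_left (abs_nonneg _) ?_
  exact_mod_cast hn i

/-- The functions `⟨t, v ·⟩` form a space of dimension at most `|A|`, so the squared norms `k b` of
the evaluation functionals have sum at most `|A|`. -/
lemma exists_sq_lin_le (v : B → A → ℤ) : ∃ k : B → ℝ, ∑ b, k b ≤ Fintype.card A ∧
    ∀ t b, lin v t b ^ 2 ≤ k b * ∑ b', lin v t b' ^ 2 := by
  classical
  let f : (A → ℝ) →ₗ[ℝ] EuclideanSpace ℝ B :=
    { toFun := fun t => WithLp.toLp 2 (lin v t)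
      map_add' := fun s t => by ext b; simp [lin_add]
      map_smul' := fun c t => by ext b; simp [lin_smul] }
  let e := stdOrthonormalBasis ℝ (LinearMap.range f)
  have hnorm : ∀ x : EuclideanSpace ℝ B, ‖x‖ ^ 2 = ∑ b, x b ^ 2 := fun x => by
    rw [EuclideanSpace.norm_sq_eq]; simp
  -- The leverage scores: diagonal entries of the orthogonal projection onto the range of `f`.
  refine ⟨fun b => ∑ i, ((e i : EuclideanSpace ℝ B) b) ^ 2, ?_, fun t b => ?_⟩
  · rw [Finset.sum_comm]
    have : ∀ i, ∑ b, ((e i : EuclideanSpace ℝ B) b) ^ 2 = 1 := fun i => by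
      rw [← hnorm]
      have := e.orthonormal.1 i
      rw [Submodule.coe_norm] at this
      rw [this, one_pow]
    simp only [this, Finset.sum_const, Finset.card_univ, Fintype.card_fin, nsmul_eq_mul, mul_one]
    have := LinearMap.finrank_range_le f
    rw [Module.finrank_fintype_fun_eq_card] at this
    exact_mod_cast this
  · let y : LinearMap.range f := ⟨f t, LinearMap.mem_range_self f t⟩
    have h1 : lin v t b = ∑ i, inner ℝ (e i) y * (e i : EuclideanSpace ℝ B) b := by
      have := congrArg (fun z : LinearMap.range f => (z : EuclideanSpace ℝ B) b) (e.sum_repr' y)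
      simp only [Submodule.coe_sum, Submodule.coe_smul, WithLp.ofLp_sum, Finset.sum_apply,
        PiLp.smul_apply, smul_eq_mul] at this
      rw [this]
      rfl
    have h2 : ∑ b', lin v t b' ^ 2 = ∑ i, (inner ℝ (e i) y) ^ 2 := by
      have h3 := e.sum_sq_norm_inner_right y
      simp only [Real.norm_eq_abs, sq_abs] at h3
      rw [h3, Submodule.coe_norm, hnorm]
      rfl
    rw [h1, h2, mul_comm]
    exact Finset.sum_mul_sq_le_sq_mul_sq _ _ _

namespace IsAdapted

variable [DecidableEq A] {v : B → A → ℤ} {c₂ c₃ : ℕ}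

/-- A dissociated set for the bounded functions `γ` represents all vectors `v b`, since `γ` is the
image of `v` under an injective matrix. -/
lemma exists_generating (hv : IsAdapted v c₂ c₃) :
    ∃ J : Finset B, 2 ^ J.card ≤ (2 * J.card * c₂ + 1) ^ Fintype.card A ∧
      ∀ b, ∃ n : B → ℤ, (∀ j, |n j| ≤ 1) ∧ ∀ a, v b a = ∑ j ∈ J, n j * v j a := by
  obtain ⟨γ, M, hM, hγ, hγv⟩ := hv.bounded
  obtain ⟨J, hJ, hn⟩ := exists_dissociated (fun b i => γ i b) c₂ (fun b i => hγ i b)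
  refine ⟨J, hJ, fun b => ?_⟩
  obtain ⟨n, hn1, hn2⟩ := hn b
  refine ⟨n, hn1, ?_⟩
  have h0 : M *ᵥ (fun a => v b a - ∑ j ∈ J, n j * v j a) = 0 := by
    funext i
    have := hn2 i
    simp only [hγv, Finset.mul_sum] at this
    rw [Finset.sum_comm] at this
    simp only [Matrix.mulVec, dotProduct, mul_sub, Finset.sum_sub_distrib, Pi.zero_apply,
      Finset.mul_sum]
    rw [this, sub_eq_zero]
    refine Finset.sum_congr rfl fun a _ => Finset.sum_congr rfl fun j _ => by ring
  have h1 := Matrix.eq_zero_of_mulVec_eq_zero hM h0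
  intro a
  have := congrFun h1 a
  simp only [Pi.zero_apply] at this
  linarith

lemma exists_symm_group (hv : IsAdapted v c₂ c₃) [DecidableEq B] :
    ∃ G : Finset (Equiv.Perm B), (∀ π ∈ G, ∀ σ ∈ G, π * σ ∈ G) ∧
      (∀ b₁ b₂, ∃ π ∈ G, π b₁ = b₂) ∧
      ∀ π ∈ G, ∀ t : A → ℝ, ∃ t' : A → ℝ, ∀ b, lin v t (π b) = lin v t' b := by
  classical
  refine ⟨Finset.univ.filter fun π => ∀ t : A → ℝ, ∃ t' : A → ℝ, ∀ b, lin v t (π b) = lin v t' b,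
    ?_, ?_, ?_⟩
  · intro π hπ σ hσ
    simp only [Finset.mem_filter, Finset.mem_univ, true_and] at hπ hσ ⊢
    intro t
    obtain ⟨t', ht'⟩ := hπ t
    obtain ⟨t'', ht''⟩ := hσ t'
    exact ⟨t'', fun b => by rw [Equiv.Perm.mul_apply, ht', ht'']⟩
  · intro b₁ b₂
    obtain ⟨π, h1, h2⟩ := hv.symm b₁ b₂
    exact ⟨π, by simpa using h2, h1⟩
  · intro π hπ
    simpa using hπ

/-- If one value `⟨t, v b₀⟩` is far from the integers, then so are many: every vector is a short
combination of the vectors indexed by any translate of the generating set `J`. -/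
lemma card_mul_sq_sub_round_le (hv : IsAdapted v c₂ c₃) {J : Finset B}
    (hJ : ∀ b, ∃ n : B → ℤ, (∀ j, |n j| ≤ 1) ∧ ∀ a, v b a = ∑ j ∈ J, n j * v j a)
    (t : A → ℝ) (b₀ : B) :
    Fintype.card B * (lin v t b₀ - round (lin v t b₀)) ^ 2
      ≤ (J.card : ℝ) ^ 2 * ∑ b, (lin v t b - round (lin v t b)) ^ 2 := by
  classical
  obtain ⟨G, hmul, htrans, hG⟩ := hv.exists_symm_group
  have hlin : ∀ (s : A → ℝ) (b : B) (n : B → ℤ), (∀ a, v b a = ∑ j ∈ J, n j * v j a) →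
      lin v s b = ∑ j ∈ J, n j * lin v s j := by
    intro s b n hn
    simp only [lin, hn, Finset.mul_sum]
    push_cast
    simp only [Finset.mul_sum]
    rw [Finset.sum_comm]
    exact Finset.sum_congr rfl fun j _ => Finset.sum_congr rfl fun a _ => by ring
  have hπ : ∀ π ∈ G, (lin v t b₀ - round (lin v t b₀)) ^ 2
      ≤ J.card * ∑ j ∈ J, (lin v t (π j) - round (lin v t (π j))) ^ 2 := by
    intro π hπ
    obtain ⟨t', ht'⟩ := hG π hπ t
    obtain ⟨n, hn1, hn2⟩ := hJ (π.symm b₀)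
    have e : lin v t b₀ = ∑ j ∈ J, n j * lin v t (π j) := by
      have h1 := ht' (π.symm b₀)
      rw [Equiv.apply_symm_apply] at h1
      rw [h1, hlin t' _ n hn2]
      exact Finset.sum_congr rfl fun j _ => by rw [ht' j]
    have h2 := abs_sub_round_sum_le J n hn1 (fun j => lin v t (π j))
    rw [← e] at h2
    rw [← sq_abs]
    refine (pow_le_pow_left₀ (abs_nonneg _) h2 2).trans ?_
    refine sq_sum_le_card_mul_sum_sq.trans (le_of_eq ?_)
    simp only [sq_abs]
  -- Summed over `G`, the right-hand side becomes the average of the squared distances over `B`.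
  have hGpos : (0 : ℝ) < G.card := by
    obtain ⟨π, hπ, _⟩ := htrans b₀ b₀
    exact_mod_cast Finset.card_pos.2 ⟨π, hπ⟩
  have hsum := Finset.sum_le_sum hπ
  rw [Finset.sum_const, nsmul_eq_mul, ← Finset.mul_sum, Finset.sum_comm] at hsum
  have havg : ∀ j ∈ J, (Fintype.card B : ℝ) * ∑ π ∈ G, (lin v t (π j) - round (lin v t (π j))) ^ 2
      = G.card * ∑ b, (lin v t b - round (lin v t b)) ^ 2 := fun j _ =>
    card_mul_sum_perm_apply G hmul htrans (fun b => (lin v t b - round (lin v t b)) ^ 2) j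
  have h3 : (Fintype.card B : ℝ) * ∑ j ∈ J, ∑ π ∈ G, (lin v t (π j) - round (lin v t (π j))) ^ 2
      = J.card * (G.card * ∑ b, (lin v t b - round (lin v t b)) ^ 2) := by
    rw [Finset.mul_sum, Finset.sum_congr rfl havg, Finset.sum_const, nsmul_eq_mul]
  have h4 := mul_le_mul_of_nonneg_left hsum (Nat.cast_nonneg (α := ℝ) (Fintype.card B))
  have h5 : (Fintype.card B : ℝ) * (J.card * ∑ j ∈ J, ∑ π ∈ G,
      (lin v t (π j) - round (lin v t (π j))) ^ 2)
      = G.card * (J.card ^ 2 * ∑ b, (lin v t b - round (lin v t b)) ^ 2) := by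
    rw [mul_left_comm, h3]; ring
  rw [h5, mul_left_comm] at h4
  exact le_of_mul_le_mul_left h4 hGpos

/-- By transitivity the leverage scores of all points of `B` are equal, hence equal to the average
`|A| / |B|`. -/
lemma card_mul_sq_lin_le (hv : IsAdapted v c₂ c₃) (t : A → ℝ) (b₀ : B) :
    Fintype.card B * lin v t b₀ ^ 2 ≤ Fintype.card A * ∑ b, lin v t b ^ 2 := by
  obtain ⟨k, hk, hkb⟩ := exists_sq_lin_le v
  have h : ∀ b, lin v t b₀ ^ 2 ≤ k b * ∑ b', lin v t b' ^ 2 := by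
    intro b
    obtain ⟨π, hπ, hs⟩ := hv.symm b b₀
    obtain ⟨t', ht'⟩ := hs t
    have h1 := hkb t' b
    rw [← ht' b, hπ] at h1
    have h2 : ∑ b', lin v t' b' ^ 2 = ∑ b', lin v t b' ^ 2 := by
      rw [← Equiv.sum_comp π fun b' => lin v t b' ^ 2]
      exact Finset.sum_congr rfl fun b' _ => by rw [ht' b']
    rwa [h2] at h1
  have h3 := Finset.sum_le_sum fun b (_ : b ∈ Finset.univ) => h b
  rw [Finset.sum_const, nsmul_eq_mul, Finset.card_univ, ← Finset.sum_mul] at h3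
  exact h3.trans (mul_le_mul_of_nonneg_right hk (Finset.sum_nonneg fun _ _ => sq_nonneg _))

/-- If all values `⟨t, v b⟩` are within `1 / (2 c₃)` of integers, then the integers are the values
of an integral functional, since every short relation maps them to an integer of modulus less
than `1`. -/
lemma exists_int_of_near (hv : IsAdapted v c₂ c₃) (hc₃ : 1 ≤ c₃) (t : A → ℝ) (n : B → ℤ)
    (h : ∀ b, |lin v t b - n b| < 1 / (2 * c₃)) :
    ∃ s : A → ℤ, ∀ b, n b = ∑ a, s a * v b a := by
  refine hv.dual n fun γ hγ hγ1 => ?_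
  have hc : (1 : ℝ) ≤ c₃ := by exact_mod_cast hc₃
  have h0 : ∑ b, (γ b : ℝ) * lin v t b = 0 := by
    simp only [lin, Finset.mul_sum]
    rw [Finset.sum_comm]
    refine Finset.sum_eq_zero fun a _ => ?_
    have h1 : ((∑ b, γ b * v b a : ℤ) : ℝ) = 0 := by rw [hγ a, Int.cast_zero]
    push_cast at h1
    calc ∑ b, (γ b : ℝ) * (t a * v b a) = t a * ∑ b, (γ b : ℝ) * v b a := by
          rw [Finset.mul_sum]; exact Finset.sum_congr rfl fun b _ => by ring
      _ = 0 := by rw [h1, mul_zero]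
  have h2 : |((∑ b, γ b * n b : ℤ) : ℝ)| < 1 := by
    have e : ((∑ b, γ b * n b : ℤ) : ℝ) = -∑ b, (γ b : ℝ) * (lin v t b - n b) := by
      simp only [mul_sub, Finset.sum_sub_distrib, h0]
      push_cast
      ring
    rw [e, abs_neg]
    calc |∑ b, (γ b : ℝ) * (lin v t b - n b)| ≤ ∑ b, |(γ b : ℝ) * (lin v t b - n b)| :=
          Finset.abs_sum_le_sum_abs _ _
      _ ≤ ∑ b, |(γ b : ℝ)| * (1 / (2 * c₃)) := Finset.sum_le_sum fun b _ => by
          rw [abs_mul]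
          exact mul_le_mul_of_nonneg_left (h b).le (abs_nonneg _)
      _ = ((∑ b, |γ b| : ℤ) : ℝ) * (1 / (2 * c₃)) := by push_cast; rw [Finset.sum_mul]
      _ ≤ (c₃ : ℝ) * (1 / (2 * c₃)) := by
          refine mul_le_mul_of_nonneg_right ?_ (by positivity)
          exact_mod_cast hγ1
      _ < 1 := by field_simp; norm_num
  have h3 : |∑ b, γ b * n b| < 1 := by exact_mod_cast h2
  exact Int.abs_lt_one_iff.1 h3

lemma eq_zero_of_lin_eq_zero (hv : IsAdapted v c₂ c₃) {t : A → ℝ} (h : ∀ b, lin v t b = 0) :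
    t = 0 := by
  funext a
  obtain ⟨k, hk⟩ := hv.gen a
  have h1 : ∑ b, (k b : ℝ) * lin v t b = t a := by
    simp only [lin, Finset.mul_sum]
    rw [Finset.sum_comm]
    have h2 : ∀ a', ∑ b, (k b : ℝ) * (t a' * v b a') = t a' * if a = a' then 1 else 0 := by
      intro a'
      have h3 : ((∑ b, k b * v b a' : ℤ) : ℝ) = if a = a' then 1 else 0 := by
        rw [hk a']; split_ifs <;> simp
      rw [← h3]
      push_cast
      rw [Finset.mul_sum]
      exact Finset.sum_congr rfl fun b _ => by ring
    simp [h2]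
  rw [← h1]
  simp [h]

end IsAdapted

end LCLT

namespace LCLT

/-! ### Fourier inversion on the torus -/

variable {A B : Type*} [Fintype A] [Fintype B]

/-- The half-open unit cube `[0, 1)^A`. -/
def unitCube (A : Type*) : Set (A → ℝ) := Set.univ.pi fun _ => Set.Ico 0 1

lemma measurableSet_unitCube : MeasurableSet (unitCube A) :=
  MeasurableSet.univ_pi fun _ => measurableSet_Ico

lemma volume_unitCube : volume (unitCube A) = 1 := by
  simp [unitCube, volume_pi_pi]

lemma integral_Ico_exp (k : ℤ) :
    ∫ x in Set.Ico (0 : ℝ) 1, Complex.exp (2 * Real.pi * Complex.I * (k * x))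
      = if k = 0 then 1 else 0 := by
  rw [integral_Ico_eq_integral_Ioc, ← intervalIntegral.integral_of_le zero_le_one]
  split_ifs with hk
  · simp [hk]
  · have hc : (2 * Real.pi * Complex.I * k : ℂ) ≠ 0 := by
      simp [hk, Real.pi_ne_zero]
    have h := integral_exp_mul_complex (a := 0) (b := 1) hc
    simp only [← mul_assoc]
    rw [h]
    have : Complex.exp (2 * Real.pi * Complex.I * k * ((1 : ℝ) : ℂ)) = 1 := by
      rw [Complex.exp_eq_one_iff]
      exact ⟨k, by push_cast; ring⟩
    rw [this]
    simp

lemma integral_unitCube_exp (k : A → ℤ) :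
    ∫ t in unitCube A, Complex.exp (2 * Real.pi * Complex.I * ∑ a, (k a * t a : ℂ))
      = if k = 0 then 1 else 0 := by
  classical
  have h1 : ∀ t : A → ℝ, Complex.exp (2 * Real.pi * Complex.I * ∑ a, (k a * t a : ℂ))
      = ∏ a, Complex.exp (2 * Real.pi * Complex.I * (k a * t a)) := fun t => by
    rw [Finset.mul_sum, Complex.exp_sum]
  simp only [h1]
  rw [unitCube, volume_pi, Measure.restrict_pi_pi,
    integral_fintype_prod_eq_prod (f := fun (a : A) (x : ℝ) =>
      Complex.exp (2 * Real.pi * Complex.I * (k a * x)))]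
  simp only [integral_Ico_exp]
  by_cases hk : k = 0
  · simp [hk]
  · obtain ⟨a, ha⟩ := Function.ne_iff.1 hk
    rw [if_neg hk]
    exact Finset.prod_eq_zero (Finset.mem_univ a) (if_neg ha)

/-- The integrand of the Fourier inversion formula for the probability that the sum of the `v b`
over a random `p`-subset equals `l`. -/
noncomputable def fourierFn (v : B → A → ℤ) (p : ℝ) (l : A → ℤ) (t : A → ℝ) : ℂ :=
  Complex.exp (-(2 * Real.pi * Complex.I * ∑ a, (l a * t a : ℂ))) * ∏ b, bernChar p (lin v t b)

/-- The probability that the sum of the `v b` over a random `p`-subset of `B` equals `l`. -/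
noncomputable def pointProb [DecidableEq A] [DecidableEq B] (v : B → A → ℤ) (p : ℝ)
    (l : A → ℤ) : ℝ :=
  ∑ S : Finset B, if ∑ b ∈ S, v b = l then p ^ S.card * (1 - p) ^ (Sᶜ).card else 0

lemma continuous_bernChar (p : ℝ) : Continuous (bernChar p) := by
  unfold bernChar
  fun_prop

lemma continuous_fourierFn (v : B → A → ℤ) (p : ℝ) (l : A → ℤ) : Continuous (fourierFn v p l) := by
  unfold fourierFn
  refine Continuous.mul (by fun_prop) (continuous_finsetProd _ fun b _ => ?_)
  exact (continuous_bernChar p).comp (continuous_lin v b)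

lemma norm_fourierFn (v : B → A → ℤ) (p : ℝ) (l : A → ℤ) (t : A → ℝ) :
    ‖fourierFn v p l t‖ = ∏ b, ‖bernChar p (lin v t b)‖ := by
  have h : (-(2 * Real.pi * Complex.I * ∑ a, (l a * t a : ℂ)))
      = ((-(2 * Real.pi * ∑ a, (l a * t a : ℝ)) : ℝ) : ℂ) * Complex.I := by
    push_cast; ring
  rw [fourierFn, norm_mul, h, Complex.norm_exp_ofReal_mul_I, one_mul, norm_prod]

lemma norm_fourierFn_le {p : ℝ} (h0 : 0 ≤ p) (h1 : p ≤ 1) (v : B → A → ℤ) (l : A → ℤ)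
    (t : A → ℝ) : ‖fourierFn v p l t‖
      ≤ Real.exp (-(8 * (p * (1 - p)) * ∑ b, (lin v t b - round (lin v t b)) ^ 2)) := by
  rw [norm_fourierFn, Finset.mul_sum, ← Finset.sum_neg_distrib, Real.exp_sum]
  exact Finset.prod_le_prod (fun _ _ => norm_nonneg _)
    fun b _ => norm_bernChar_le_exp_round h0 h1 _

lemma norm_fourierFn_le_one {p : ℝ} (h0 : 0 ≤ p) (h1 : p ≤ 1) (v : B → A → ℤ) (l : A → ℤ)
    (t : A → ℝ) : ‖fourierFn v p l t‖ ≤ 1 := by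
  refine (norm_fourierFn_le h0 h1 v l t).trans (Real.exp_le_one_iff.2 (neg_nonpos.2 ?_))
  have : 0 ≤ p * (1 - p) := mul_nonneg h0 (by linarith)
  positivity

lemma fourierFn_eq_sum [DecidableEq B] (v : B → A → ℤ) (p : ℝ) (l : A → ℤ) (t : A → ℝ) :
    fourierFn v p l t = ∑ S : Finset B, ((p ^ S.card * (1 - p) ^ (Sᶜ).card : ℝ) : ℂ) *
      Complex.exp (2 * Real.pi * Complex.I * ∑ a, (((∑ b ∈ S, v b - l) a : ℤ) * t a : ℂ)) := by
  have h1 : ∏ b, bernChar p (lin v t b) = ∏ b : B,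
      (p * Complex.exp (2 * Real.pi * Complex.I * lin v t b) + (1 - p : ℂ)) :=
    Finset.prod_congr rfl fun b _ => by rw [bernChar, add_comm]
  rw [fourierFn, h1, Finset.prod_add, Finset.powerset_univ, Finset.mul_sum]
  refine Finset.sum_congr rfl fun S _ => ?_
  rw [Finset.prod_const, Finset.prod_mul_distrib, Finset.prod_const, ← Complex.exp_sum,
    ← Finset.compl_eq_univ_sdiff]
  have h2 : (2 * Real.pi * Complex.I * ∑ a, (((∑ b ∈ S, v b - l) a : ℤ) * t a : ℂ))
      = -(2 * Real.pi * Complex.I * ∑ a, (l a * t a : ℂ))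
        + ∑ b ∈ S, 2 * Real.pi * Complex.I * (lin v t b : ℂ) := by
    rw [← Finset.mul_sum]
    have : ∑ b ∈ S, (lin v t b : ℂ) = ∑ a, ((∑ b ∈ S, v b a : ℤ) * t a : ℂ) := by
      simp only [lin]
      push_cast
      rw [Finset.sum_comm]
      refine Finset.sum_congr rfl fun a _ => ?_
      rw [Finset.sum_mul]
      exact Finset.sum_congr rfl fun b _ => mul_comm _ _
    rw [this]
    simp only [Pi.sub_apply, Finset.sum_apply, Int.cast_sub, sub_mul, Finset.sum_sub_distrib]
    ring
  rw [h2, Complex.exp_add]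
  push_cast
  ring

lemma integral_unitCube_fourierFn [DecidableEq A] [DecidableEq B] (v : B → A → ℤ) (p : ℝ)
    (l : A → ℤ) : ∫ t in unitCube A, fourierFn v p l t = pointProb v p l := by
  simp only [fourierFn_eq_sum]
  rw [integral_finsetSum]
  · simp only [integral_const_mul, integral_unitCube_exp, sub_eq_zero, pointProb]
    push_cast
    refine Finset.sum_congr rfl fun S _ => ?_
    split_ifs <;> simp
  · intro S _
    refine Integrable.const_mul ?_ _
    refine Measure.integrableOn_of_bounded (M := 1) (by rw [volume_unitCube]; simp)
      (Continuous.aestronglyMeasurable (by fun_prop)) (Filter.Eventually.of_forall fun t => ?_)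
    have h : (2 * Real.pi * Complex.I * ∑ a, (((∑ b ∈ S, v b - l) a : ℤ) * t a : ℂ))
      = ((2 * Real.pi * ∑ a, (((∑ b ∈ S, v b - l) a : ℤ) * t a : ℝ) : ℝ) : ℂ) * Complex.I := by
      push_cast; ring
    rw [h, Complex.norm_exp_ofReal_mul_I]

lemma bernChar_intCast_add (p x : ℝ) (n : ℤ) : bernChar p (n + x) = bernChar p x := by
  have : (2 * Real.pi * Complex.I * ((n + x : ℝ) : ℂ)) = 2 * Real.pi * Complex.I * x
      + n * (2 * Real.pi * Complex.I) := by push_cast; ring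
  rw [bernChar, bernChar, this, Complex.exp_periodic.int_mul n]

lemma fourierFn_int_add (v : B → A → ℤ) (p : ℝ) (l s : A → ℤ) (t : A → ℝ) :
    fourierFn v p l ((fun a => (s a : ℝ)) + t) = fourierFn v p l t := by
  rw [fourierFn, fourierFn]
  congr 1
  · have : -(2 * Real.pi * Complex.I * ∑ a, (l a * (((fun a => (s a : ℝ)) + t) a : ℝ) : ℂ))
        = -(2 * Real.pi * Complex.I * ∑ a, (l a * t a : ℂ))
          + (-∑ a, l a * s a : ℤ) * (2 * Real.pi * Complex.I) := by
      simp only [Pi.add_apply]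
      push_cast
      simp only [mul_add, Finset.sum_add_distrib]
      ring
    rw [this, Complex.exp_periodic.int_mul]
  · refine Finset.prod_congr rfl fun b _ => ?_
    rw [lin_add, lin_intCast, bernChar_intCast_add]

/-- The frequencies `t` at which all phases `⟨t, v b⟩` are smaller than `r`. -/
def smallPhases (v : B → A → ℤ) (r : ℝ) : Set (A → ℝ) := {t | ∀ b, |lin v t b| < r}

/-- The frequencies `t` at which all phases `⟨t, v b⟩` are closer than `r` to the integers. -/
def nearIntegerPhases (v : B → A → ℤ) (r : ℝ) : Set (A → ℝ) :=
  {t | ∀ b, |lin v t b - round (lin v t b)| < r}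

lemma measurableSet_smallPhases (v : B → A → ℤ) (r : ℝ) : MeasurableSet (smallPhases v r) := by
  have : smallPhases v r = ⋂ b, {t | |lin v t b| < r} := by ext; simp [smallPhases]
  rw [this]
  exact MeasurableSet.iInter fun b =>
    (isOpen_lt (continuous_lin v b).abs continuous_const).measurableSet

lemma measurableSet_nearIntegerPhases (v : B → A → ℤ) (r : ℝ) :
    MeasurableSet (nearIntegerPhases v r) := by
  have : nearIntegerPhases v r = ⋂ b, {t | |lin v t b - round (lin v t b)| < r} := by
    ext; simp [nearIntegerPhases]
  rw [this]
  refine MeasurableSet.iInter fun b => measurableSet_lt ?_ measurable_const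
  have h := (continuous_lin v b).measurable
  have h2 : Measurable fun t => ((round (lin v t b) : ℤ) : ℝ) :=
    (measurable_from_top (f := fun n : ℤ => (n : ℝ))).comp <| by
      simp only [round_eq]
      exact Int.measurable_floor.comp (h.add_const _)
  exact (h.sub h2).norm

lemma mem_span_basisFun_iff [DecidableEq A] (x : A → ℝ) :
    x ∈ Submodule.span ℤ (Set.range (Pi.basisFun ℝ A)) ↔ ∃ s : A → ℤ, x = fun a => (s a : ℝ) := by
  rw [Module.Basis.mem_span_iff_repr_mem]
  constructor
  · intro h
    choose s hs using h
    refine ⟨s, funext fun a => ?_⟩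
    have := hs a
    simp at this
    exact this.symm
  · rintro ⟨s, rfl⟩ a
    exact ⟨s a, by simp⟩

lemma far_exponent_le {q N c K R : ℝ} (hq : 0 ≤ q) (hc : 1 ≤ c) (hK : 0 < K)
    (h : N * (1 / (2 * c)) ^ 2 ≤ K ^ 2 * R) :
    2 * (q * N) / (c ^ 2 * K ^ 2) ≤ 8 * q * R := by
  have hc0 : 0 < c := by linarith
  rw [div_le_iff₀ (by positivity)]
  have h5 : N ≤ 4 * c ^ 2 * (K ^ 2 * R) := by
    have : N = 4 * c ^ 2 * (N * (1 / (2 * c)) ^ 2) := by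
      field_simp
      norm_num
    rw [this]
    exact mul_le_mul_of_nonneg_left h (by positivity)
  nlinarith [mul_le_mul_of_nonneg_left h5 hq]

namespace IsAdapted

variable [DecidableEq A] {v : B → A → ℤ} {c₂ c₃ : ℕ}

/-- The set of frequencies with phases near the integers is the disjoint union of the
`ℤ^A`-translates of the set of frequencies with small phases. Replacing its part in the unit cube
by the latter set gives another fundamental domain of `ℤ^A`. -/
lemma isAddFundamentalDomain (hv : IsAdapted v c₂ c₃) (hc₃ : 1 ≤ c₃) :
    IsAddFundamentalDomain (Submodule.span ℤ (Set.range (Pi.basisFun ℝ A)))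
      (smallPhases v (1 / (2 * c₃)) ∪ (unitCube A \ nearIntegerPhases v (1 / (2 * c₃))))
      (volume : Measure (A → ℝ)) := by
  have hc : (1 : ℝ) ≤ c₃ := by exact_mod_cast hc₃
  have hr : 1 / (2 * (c₃ : ℝ)) ≤ 1 / 2 := by
    rw [div_le_div_iff₀ (by positivity) (by norm_num)]; linarith
  set r : ℝ := 1 / (2 * c₃) with hrdef
  have hround : ∀ (x : ℝ) (n : ℤ), |x - n| < r → round x = n := by
    intro x n h
    have h1 := abs_sub_round x
    have h2 : |((round x - n : ℤ) : ℝ)| < 1 := by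
      push_cast
      have : (round x : ℝ) - n = (x - n) - (x - round x) := by ring
      rw [this]
      refine (abs_sub _ _).trans_lt (by linarith)
    have h3 : |round x - n| < 1 := by exact_mod_cast h2
    have := Int.abs_lt_one_iff.1 h3
    omega
  have hper : ∀ (s : A → ℤ) (x : A → ℝ), (fun a => (s a : ℝ)) + x ∈ nearIntegerPhases v r ↔
      x ∈ nearIntegerPhases v r := by
    intro s x
    refine forall_congr' fun b => ?_
    rw [lin_add, lin_intCast, round_intCast_add, Int.cast_add, add_sub_add_left_eq_sub]
  have hsub : smallPhases v r ⊆ nearIntegerPhases v r := fun t ht b =>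
    (round_le (lin v t b) 0).trans_lt (by simpa using ht b)
  refine IsAddFundamentalDomain.mk' (((measurableSet_smallPhases v r).union
    (measurableSet_unitCube.diff (measurableSet_nearIntegerPhases v r))).nullMeasurableSet) ?_
  intro x
  by_cases hx : x ∈ nearIntegerPhases v r
  · obtain ⟨s, hs⟩ := hv.exists_int_of_near hc₃ x (fun b => round (lin v x b)) hx
    have hmem : (fun a => ((-s a : ℤ) : ℝ)) ∈ Submodule.span ℤ (Set.range (Pi.basisFun ℝ A)) :=
      (mem_span_basisFun_iff _).2 ⟨fun a => -s a, rfl⟩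
    refine ⟨⟨_, hmem⟩, Or.inl fun b => ?_, ?_⟩
    · change |lin v ((fun a => ((-s a : ℤ) : ℝ)) + x) b| < r
      rw [lin_add, lin_intCast]
      have h1 := hx b
      rw [hs b] at h1
      have h2 : ((∑ a, -s a * v b a : ℤ) : ℝ) + lin v x b
          = lin v x b - ((∑ a, s a * v b a : ℤ) : ℝ) := by
        simp only [neg_mul, Finset.sum_neg_distrib, Int.cast_neg]; ring
      rwa [h2]
    · -- A translate of `x` with small phases determines the rounded phases of `x`, hence itself.
      rintro ⟨g, hg⟩ hgx
      obtain ⟨s', rfl⟩ := (mem_span_basisFun_iff g).1 hg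
      change (fun a => (s' a : ℝ)) + x ∈ _ at hgx
      have hgx' : (fun a => (s' a : ℝ)) + x ∈ smallPhases v r := by
        rcases hgx with h | h
        · exact h
        · exact absurd ((hper s' x).2 hx) h.2
      refine Subtype.ext ?_
      have h0 : (fun a => (s' a : ℝ)) - (fun a => ((-s a : ℤ) : ℝ)) = 0 := by
        refine hv.eq_zero_of_lin_eq_zero fun b => ?_
        have h1 := hgx' b
        rw [lin_add, lin_intCast] at h1
        have h2 : round (lin v x b) = -∑ a, s' a * v b a := hround _ _ (by
          push_cast at h1 ⊢
          rw [sub_neg_eq_add, add_comm]; exact h1)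
        rw [hs b] at h2
        rw [lin_sub, lin_intCast, lin_intCast, ← Int.cast_sub]
        simp only [neg_mul, Finset.sum_neg_distrib]
        rw [h2]
        simp
      exact sub_eq_zero.1 h0
  · -- The far frequencies are invariant under translation, so the unit cube is a domain for them.
    obtain ⟨g, hg, huniq⟩ := ZSpan.exist_unique_vadd_mem_fundamentalDomain (Pi.basisFun ℝ A) x
    rw [ZSpan.fundamentalDomain_pi_basisFun] at hg
    obtain ⟨s, hs⟩ := (mem_span_basisFun_iff (g : A → ℝ)).1 g.2
    refine ⟨g, Or.inr ⟨hg, ?_⟩, ?_⟩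
    · change (g : A → ℝ) + x ∉ _
      rw [hs, hper]
      exact hx
    · intro g' hg'
      refine huniq g' ?_
      rw [ZSpan.fundamentalDomain_pi_basisFun]
      obtain ⟨s', hs'⟩ := (mem_span_basisFun_iff (g' : A → ℝ)).1 g'.2
      rcases hg' with h | h
      · have h1 : (g' : A → ℝ) + x ∈ nearIntegerPhases v r := hsub h
        rw [hs', hper] at h1
        exact absurd h1 hx
      · exact h.1

/-- Fourier inversion over the modified fundamental domain. -/
lemma pointProb_eq (hv : IsAdapted v c₂ c₃) (hc₃ : 1 ≤ c₃) [DecidableEq B] {p : ℝ} (h0 : 0 ≤ p)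
    (h1 : p ≤ 1) (l : A → ℤ) :
    IntegrableOn (fourierFn v p l) (smallPhases v (1 / (2 * c₃))) ∧
    (pointProb v p l : ℂ) = (∫ t in smallPhases v (1 / (2 * c₃)), fourierFn v p l t)
      + ∫ t in unitCube A \ nearIntegerPhases v (1 / (2 * c₃)), fourierFn v p l t := by
  have hD := hv.isAddFundamentalDomain hc₃
  have hcube : IsAddFundamentalDomain (Submodule.span ℤ (Set.range (Pi.basisFun ℝ A)))
      (unitCube A) (volume : Measure (A → ℝ)) := by
    have := ZSpan.isAddFundamentalDomain (Pi.basisFun ℝ A) (volume : Measure (A → ℝ))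
    rwa [ZSpan.fundamentalDomain_pi_basisFun] at this
  have hcount : Countable (Submodule.span ℤ (Set.range (Pi.basisFun ℝ A))) := by
    infer_instance
  have : VAddInvariantMeasure (Submodule.span ℤ (Set.range (Pi.basisFun ℝ A))) (A → ℝ) volume :=
    inferInstanceAs (VAddInvariantMeasure
      (Submodule.span ℤ (Set.range (Pi.basisFun ℝ A))).toAddSubgroup (A → ℝ) volume)
  have hper : ∀ (g : Submodule.span ℤ (Set.range (Pi.basisFun ℝ A))) (x : A → ℝ),
      fourierFn v p l (g +ᵥ x) = fourierFn v p l x := by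
    intro g x
    obtain ⟨s, hs⟩ := (mem_span_basisFun_iff (g : A → ℝ)).1 g.2
    change fourierFn v p l ((g : A → ℝ) + x) = _
    rw [hs, fourierFn_int_add]
  have hvol := hD.measure_eq hcube
  rw [volume_unitCube] at hvol
  have hint : IntegrableOn (fourierFn v p l) (smallPhases v (1 / (2 * c₃)) ∪
      (unitCube A \ nearIntegerPhases v (1 / (2 * c₃)))) :=
    Measure.integrableOn_of_bounded (M := 1) (by rw [hvol]; simp)
      (continuous_fourierFn v p l).aestronglyMeasurable
      (Filter.Eventually.of_forall fun t => norm_fourierFn_le_one h0 h1 v l t)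
  refine ⟨hint.mono_set Set.subset_union_left, ?_⟩
  rw [← integral_unitCube_fourierFn, hcube.setIntegral_eq hD hper, setIntegral_union]
  · refine Set.disjoint_left.2 fun t ht ht' => ht'.2 fun b => ?_
    exact (round_le (lin v t b) 0).trans_lt (by simpa using ht b)
  · exact measurableSet_unitCube.diff (measurableSet_nearIntegerPhases v _)
  · exact hint.mono_set Set.subset_union_left
  · exact hint.mono_set Set.subset_union_right

/-- The contribution of the frequencies with a phase far from the integers: one far phase forces the
squared distances of all phases to the integers to be large in the mean. `K` bounds the size of a
dissociated set. -/
lemma norm_integral_far_le (hv : IsAdapted v c₂ c₃) (hc₃ : 1 ≤ c₃) {p : ℝ} (h0 : 0 ≤ p)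
    (h1 : p ≤ 1) (l : A → ℤ) {K : ℝ}
    (hK : ∀ J : ℕ, 2 ^ J ≤ (2 * J * c₂ + 1) ^ Fintype.card A → (J : ℝ) ≤ K) (hK0 : 0 < K) :
    ‖∫ t in unitCube A \ nearIntegerPhases v (1 / (2 * c₃)), fourierFn v p l t‖
      ≤ Real.exp (-(2 * (p * (1 - p) * Fintype.card B) / (c₃ ^ 2 * K ^ 2))) := by
  have hq : 0 ≤ p * (1 - p) := mul_nonneg h0 (by linarith)
  have hc : (1 : ℝ) ≤ c₃ := by exact_mod_cast hc₃
  obtain ⟨J, hJ, hgen⟩ := hv.exists_generating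
  have hJK := hK _ hJ
  have hvol : volume (unitCube A \ nearIntegerPhases v (1 / (2 * c₃))) ≤ 1 :=
    (measure_mono Set.sdiff_subset).trans volume_unitCube.le
  refine (norm_setIntegral_le_of_norm_le_const (C := Real.exp
    (-(2 * (p * (1 - p) * Fintype.card B) / (c₃ ^ 2 * K ^ 2)))) (hvol.trans_lt (by simp))
    fun t ht => ?_).trans ?_
  · refine (norm_fourierFn_le h0 h1 v l t).trans (Real.exp_le_exp.2 (neg_le_neg ?_))
    have hfar : ∃ b, 1 / (2 * (c₃ : ℝ)) ≤ |lin v t b - round (lin v t b)| := by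
      by_contra! hcon
      exact ht.2 hcon
    obtain ⟨b₀, hb₀⟩ := hfar
    have h2 := hv.card_mul_sq_sub_round_le hgen t b₀
    have h3 : (1 / (2 * (c₃ : ℝ))) ^ 2 ≤ (lin v t b₀ - round (lin v t b₀)) ^ 2 := by
      rw [← sq_abs (lin v t b₀ - _)]
      gcongr
    have hR0 : 0 ≤ ∑ b, (lin v t b - round (lin v t b)) ^ 2 :=
      Finset.sum_nonneg fun _ _ => sq_nonneg _
    refine far_exponent_le hq hc hK0 ((mul_le_mul_of_nonneg_left h3 (Nat.cast_nonneg _)).trans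
      (h2.trans (mul_le_mul_of_nonneg_right ?_ hR0)))
    exact pow_le_pow_left₀ (Nat.cast_nonneg _) hJK 2
  · refine mul_le_of_le_one_right (Real.exp_pos _).le ?_
    exact ENNReal.toReal_le_of_le_ofReal zero_le_one (by simpa using hvol)

end IsAdapted

end LCLT

namespace LCLT

/-! ### Gaussian integrals -/

section Gaussian

variable {A : Type*} [Fintype A] [DecidableEq A]

open scoped MatrixOrder Matrix.Norms.L2Operator in
lemma exists_eq_transpose_mul_self {S : Matrix A A ℝ} (hS : S.PosDef) :
    ∃ L : Matrix A A ℝ, S = Lᵀ * L ∧ L.det ≠ 0 := by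
  obtain ⟨L, hL⟩ := CStarAlgebra.nonneg_iff_eq_star_mul_self.mp hS.posSemidef.nonneg
  have hL' : S = Lᵀ * L := by
    rw [hL, Matrix.star_eq_conjTranspose, Matrix.conjTranspose_eq_transpose_of_trivial]
  refine ⟨L, hL', fun h => ?_⟩
  have := hS.det_pos
  rw [hL', Matrix.det_mul, h, mul_zero] at this
  exact lt_irrefl _ this

lemma integrable_comp_mulVec {L : Matrix A A ℝ} (hL : L.det ≠ 0) {f : (A → ℝ) → ℂ}
    (hf : Integrable f) : Integrable fun t => f (L *ᵥ t) := by
  have hmap := Real.map_matrix_volume_pi_eq_smul_volume_pi hL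
  have hf' : Integrable f (Measure.map (Matrix.toLin' L) volume) := by
    rw [hmap]; exact hf.smul_measure ENNReal.ofReal_ne_top
  exact hf'.comp_measurable (by
    have : Continuous (Matrix.toLin' L) := LinearMap.continuous_of_finiteDimensional _
    exact this.measurable)

lemma integral_comp_mulVec {L : Matrix A A ℝ} (hL : L.det ≠ 0) {f : (A → ℝ) → ℂ}
    (hf : Integrable f) : ∫ t, f (L *ᵥ t) = (|L.det|⁻¹ : ℝ) * ∫ t, f t := by
  have hmap := Real.map_matrix_volume_pi_eq_smul_volume_pi hL
  have hcont : Continuous (Matrix.toLin' L) := LinearMap.continuous_of_finiteDimensional _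
  have hf' : AEStronglyMeasurable f (Measure.map (Matrix.toLin' L) volume) := by
    rw [hmap]; exact hf.aestronglyMeasurable.smul_measure _
  have h := integral_map hcont.aemeasurable hf'
  rw [hmap, integral_smul_measure, ENNReal.toReal_ofReal (abs_nonneg _), abs_inv] at h
  simp only [Matrix.toLin'_apply] at h
  rw [← h, Complex.real_smul]

/-- Fourier transform of a nondegenerate Gaussian. -/
lemma gaussian_fourier {S : Matrix A A ℝ} (hS : S.PosDef) {β : ℝ} (hβ : 0 < β) (x : A → ℝ) :
    Integrable (fun t : A → ℝ => Complex.exp (-(β * (t ⬝ᵥ S *ᵥ t) : ℝ)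
      - 2 * Real.pi * Complex.I * ∑ a, (x a * t a : ℂ))) ∧
    ∫ t : A → ℝ, Complex.exp (-(β * (t ⬝ᵥ S *ᵥ t) : ℝ)
      - 2 * Real.pi * Complex.I * ∑ a, (x a * t a : ℂ))
      = (((Real.pi / β) ^ ((Fintype.card A : ℝ) / 2) / √S.det *
        Real.exp (-(Real.pi ^ 2 / β) * (x ⬝ᵥ S⁻¹ *ᵥ x)) : ℝ) : ℂ) := by
  obtain ⟨L, rfl, hL⟩ := exists_eq_transpose_mul_self hS
  have hunit : IsUnit L.det := isUnit_iff_ne_zero.2 hL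
  have hb : 0 < (β : ℂ).re := by simpa using hβ
  let w : A → ℝ := (L⁻¹)ᵀ *ᵥ x
  have hxw : x = Lᵀ *ᵥ w := by
    simp only [w]
    rw [Matrix.mulVec_mulVec, ← Matrix.transpose_mul, Matrix.nonsing_inv_mul L hunit,
      Matrix.transpose_one, Matrix.one_mulVec]
  let f : (A → ℝ) → ℂ := fun u => Complex.exp (-β * ∑ i, (u i : ℂ) ^ 2
    + ∑ i, (-(2 * Real.pi * Complex.I * w i)) * (u i : ℂ))
  have hf : Integrable f := GaussianFourier.integrable_cexp_neg_mul_sum_add hb _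
  have hfe : ∀ t, f (L *ᵥ t) = Complex.exp (-(β * (t ⬝ᵥ (Lᵀ * L) *ᵥ t) : ℝ)
      - 2 * Real.pi * Complex.I * ∑ a, (x a * t a : ℂ)) := by
    intro t
    have h1 : t ⬝ᵥ (Lᵀ * L) *ᵥ t = ∑ i, (L *ᵥ t) i ^ 2 := by
      rw [← Matrix.mulVec_mulVec, Matrix.dotProduct_mulVec, Matrix.vecMul_transpose]
      simp [dotProduct, sq]
    have h2 : ∑ a, x a * t a = ∑ i, w i * (L *ᵥ t) i := by
      change x ⬝ᵥ t = w ⬝ᵥ (L *ᵥ t)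
      rw [Matrix.dotProduct_mulVec, ← Matrix.mulVec_transpose, ← hxw]
    have h2' : ∑ a, (x a * t a : ℂ) = ((∑ i, w i * (L *ᵥ t) i : ℝ) : ℂ) := by
      rw [← h2]; push_cast; rfl
    simp only [f]
    rw [h1, h2']
    congr 1
    push_cast
    simp only [Finset.mul_sum]
    rw [sub_eq_add_neg, ← Finset.sum_neg_distrib, ← Finset.sum_neg_distrib]
    congr 1
    · exact Finset.sum_congr rfl fun i _ => by ring
    · exact Finset.sum_congr rfl fun i _ => by ring
  refine ⟨(integrable_comp_mulVec hL hf).congr (Filter.Eventually.of_forall hfe), ?_⟩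
  rw [← integral_congr_ae (Filter.Eventually.of_forall hfe), integral_comp_mulVec hL hf]
  have hI := GaussianFourier.integral_cexp_neg_mul_sum_add hb
    (fun i : A => -(2 * Real.pi * Complex.I * w i))
  rw [hI]
  have hdet : √(Lᵀ * L).det = |L.det| := by
    rw [Matrix.det_mul, Matrix.det_transpose, Real.sqrt_mul_self_eq_abs]
  have hquad : x ⬝ᵥ (Lᵀ * L)⁻¹ *ᵥ x = ∑ i, w i ^ 2 := by
    rw [Matrix.mul_inv_rev, ← Matrix.mulVec_mulVec, Matrix.dotProduct_mulVec,
      ← Matrix.mulVec_transpose, ← Matrix.transpose_nonsing_inv]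
    simp [dotProduct, sq, w]
  have h3 : (∑ i, (-(2 * Real.pi * Complex.I * w i)) ^ 2) / (4 * β)
      = ((-(Real.pi ^ 2 / β) * ∑ i, w i ^ 2 : ℝ) : ℂ) := by
    have : ∀ i, (-(2 * Real.pi * Complex.I * w i)) ^ 2 = (-(4 * Real.pi ^ 2) : ℂ) * (w i : ℂ) ^ 2 :=
      fun i => by linear_combination (4 * Real.pi ^ 2 * (w i : ℂ) ^ 2) * Complex.I_sq
    simp only [this]
    rw [← Finset.mul_sum]
    push_cast
    have hβ' : (β : ℂ) ≠ 0 := by exact_mod_cast hβ.ne'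
    field_simp
  rw [h3, hdet, hquad]
  have h4 : ((Real.pi : ℂ) / β) ^ ((Fintype.card A : ℂ) / 2)
      = (((Real.pi / β) ^ ((Fintype.card A : ℝ) / 2) : ℝ) : ℂ) := by
    rw [Complex.ofReal_cpow (by positivity)]
    push_cast
    rfl
  rw [h4]
  push_cast
  ring

lemma gaussian_integral {S : Matrix A A ℝ} (hS : S.PosDef) {β : ℝ} (hβ : 0 < β) :
    Integrable (fun t : A → ℝ => Real.exp (-(β * (t ⬝ᵥ S *ᵥ t)))) ∧
    ∫ t : A → ℝ, Real.exp (-(β * (t ⬝ᵥ S *ᵥ t)))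
      = (Real.pi / β) ^ ((Fintype.card A : ℝ) / 2) / √S.det := by
  obtain ⟨h1, h2⟩ := gaussian_fourier hS hβ 0
  have h3 : ∀ t : A → ℝ, Complex.exp (-(β * (t ⬝ᵥ S *ᵥ t) : ℝ)
      - 2 * Real.pi * Complex.I * ∑ a, (((0 : A → ℝ) a : ℝ) * t a : ℂ))
      = ((Real.exp (-(β * (t ⬝ᵥ S *ᵥ t))) : ℝ) : ℂ) := fun t => by
    push_cast
    simp
  simp only [h3] at h1 h2
  refine ⟨h1.re, ?_⟩
  rw [integral_complex_ofReal] at h2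
  have h4 := Complex.ofReal_injective h2
  rw [h4]
  simp

end Gaussian

/-! ### The Gram matrix -/

variable {A B : Type*} [Fintype A] [Fintype B]

/-- The Gram matrix of the coordinate functions of `v`. -/
def gram (v : B → A → ℤ) : Matrix A A ℝ := Matrix.of fun a a' => ∑ b, (v b a : ℝ) * v b a'

lemma dotProduct_gram_mulVec (v : B → A → ℤ) (t : A → ℝ) :
    t ⬝ᵥ gram v *ᵥ t = ∑ b, lin v t b ^ 2 := by
  simp only [dotProduct, Matrix.mulVec, gram, Matrix.of_apply, lin, sq, Finset.sum_mul,
    Finset.mul_sum]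
  rw [Finset.sum_comm_cycle]
  exact Finset.sum_congr rfl fun b _ => Finset.sum_congr rfl fun a _ =>
    Finset.sum_congr rfl fun a' _ => by ring

namespace IsAdapted

variable [DecidableEq A] {v : B → A → ℤ} {c₂ c₃ : ℕ}

lemma posDef_gram (hv : IsAdapted v c₂ c₃) : (gram v).PosDef := by
  refine Matrix.PosDef.of_dotProduct_mulVec_pos ?_ fun x hx => ?_
  · ext a a'
    simp [gram, mul_comm]
  · rw [star_trivial, dotProduct_gram_mulVec]
    have h0 : ∀ b ∈ Finset.univ, 0 ≤ lin v x b ^ 2 := fun _ _ => sq_nonneg _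
    refine lt_of_le_of_ne (Finset.sum_nonneg h0) fun h => hx ?_
    refine hv.eq_zero_of_lin_eq_zero fun b => ?_
    have := (Finset.sum_eq_zero_iff_of_nonneg h0).1 h.symm b (Finset.mem_univ b)
    exact pow_eq_zero_iff (two_ne_zero) |>.1 this

end IsAdapted

/-- The arithmetic-geometric mean inequality for the eigenvalues. -/
lemma posSemidef_det_le [DecidableEq A] {S : Matrix A A ℝ} (hS : S.PosSemidef) {c : ℝ}
    (h : ∀ a, S a a ≤ c) : S.det ≤ c ^ Fintype.card A := by
  rcases isEmpty_or_nonempty A with hA | hA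
  · simp
  have hd : (0 : ℝ) < Fintype.card A := by exact_mod_cast Fintype.card_pos
  have hdet := hS.1.det_eq_prod_eigenvalues
  have htr := hS.1.trace_eq_sum_eigenvalues
  simp only [RCLike.ofReal_real_eq_id, id] at hdet htr
  have hnn := hS.eigenvalues_nonneg
  have hamgm := Real.geom_mean_le_arith_mean Finset.univ (fun _ : A => (1 : ℝ))
    hS.1.eigenvalues (fun _ _ => zero_le_one) (by simpa using hd) (fun i _ => hnn i)
  simp only [Real.rpow_one, one_mul, Finset.sum_const, Finset.card_univ, nsmul_eq_mul, mul_one]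
    at hamgm
  have htr2 : S.trace ≤ Fintype.card A * c := by
    have := Finset.sum_le_sum fun a (_ : a ∈ Finset.univ) => h a
    simpa [Matrix.trace] using this
  have hP : 0 ≤ ∏ i, hS.1.eigenvalues i := Finset.prod_nonneg fun i _ => hnn i
  have h2 : (∏ i, hS.1.eigenvalues i) ^ ((Fintype.card A : ℝ)⁻¹) ≤ c := by
    refine hamgm.trans ?_
    rw [div_le_iff₀ hd, ← htr]
    linarith
  rw [hdet]
  have h3 := pow_le_pow_left₀ (Real.rpow_nonneg hP _) h2 (Fintype.card A)
  rwa [← Real.rpow_natCast, ← Real.rpow_mul hP, inv_mul_cancel₀ hd.ne', Real.rpow_one] at h3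

/-- The integer functions `γ` generate a sublattice of the lattice generated by the coordinate
functions of `v`, so its covolume, which is bounded by the size of `γ`, is at least as large. -/
lemma IsAdapted.det_gram_le [DecidableEq A] {v : B → A → ℤ} {c₂ c₃ : ℕ}
    (hv : IsAdapted v c₂ c₃) :
    (gram v).det ≤ ((c₂ : ℝ) ^ 2 * Fintype.card B) ^ Fintype.card A := by
  obtain ⟨γ, M, hM, hγ, hγv⟩ := hv.bounded
  let M' : Matrix A A ℝ := M.map (Int.cast : ℤ → ℝ)
  have hdetM : M'.det = (M.det : ℝ) := (Int.cast_det M).symm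
  have hent : ∀ i j, (M' * gram v * M'ᵀ) i j = ∑ b, (γ i b : ℝ) * γ j b := by
    intro i j
    simp only [Matrix.mul_apply, Matrix.transpose_apply, gram, Matrix.of_apply, M', Matrix.map_apply,
      hγv, Finset.sum_mul, Finset.mul_sum]
    push_cast
    simp only [Finset.sum_mul, Finset.mul_sum]
    rw [Finset.sum_comm_cycle]
    refine Finset.sum_congr rfl fun b _ => ?_
    exact Finset.sum_congr rfl fun a _ => Finset.sum_congr rfl fun a' _ => by ring
  have hpsd : (M' * gram v * M'ᵀ).PosSemidef := by
    have := hv.posDef_gram.posSemidef.mul_mul_conjTranspose_same M'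
    rwa [Matrix.conjTranspose_eq_transpose_of_trivial] at this
  have hdiag : ∀ i, (M' * gram v * M'ᵀ) i i ≤ (c₂ : ℝ) ^ 2 * Fintype.card B := by
    intro i
    rw [hent]
    calc ∑ b, (γ i b : ℝ) * γ i b ≤ ∑ _b : B, (c₂ : ℝ) ^ 2 := by
          refine Finset.sum_le_sum fun b _ => ?_
          have : |(γ i b : ℝ)| ≤ c₂ := by exact_mod_cast hγ i b
          rw [← sq, ← sq_abs]
          exact pow_le_pow_left₀ (abs_nonneg _) this 2
      _ = _ := by simp [mul_comm]
  have h := posSemidef_det_le hpsd hdiag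
  rw [Matrix.det_mul, Matrix.det_mul, Matrix.det_transpose, hdetM] at h
  have h1 : (1 : ℝ) ≤ (M.det : ℝ) * M.det := by
    have : (1 : ℤ) ≤ M.det * M.det := by
      have := mul_self_pos.2 hM
      omega
    exact_mod_cast this
  have h2 := hv.posDef_gram.det_pos
  nlinarith

end LCLT

namespace LCLT

/-! ### Comparison with the Gaussian near the origin -/

section Comparison

variable {A B : Type*} [Fintype A] [Fintype B]

/-- The Fourier transform of the Gaussian with the mean and covariance of the sum of the `v b` over a
random `p`-subset, multiplied by the character of `l`. -/
noncomputable def gaussFn (v : B → A → ℤ) (p : ℝ) (l : A → ℤ) (t : A → ℝ) : ℂ :=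
  Complex.exp (-((2 * Real.pi ^ 2 * (p * (1 - p)) * ∑ b, lin v t b ^ 2 : ℝ) : ℂ)
    - 2 * Real.pi * Complex.I * ∑ a, (((l a - p * ∑ b, (v b a : ℝ) : ℝ) : ℂ) * t a))

lemma norm_gaussFn (v : B → A → ℤ) (p : ℝ) (l : A → ℤ) (t : A → ℝ) :
    ‖gaussFn v p l t‖ = Real.exp (-(2 * Real.pi ^ 2 * (p * (1 - p)) * ∑ b, lin v t b ^ 2)) := by
  have h : -((2 * Real.pi ^ 2 * (p * (1 - p)) * ∑ b, lin v t b ^ 2 : ℝ) : ℂ)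
    - 2 * Real.pi * Complex.I * ∑ a, (((l a - p * ∑ b, (v b a : ℝ) : ℝ) : ℂ) * t a)
    = ((-(2 * Real.pi ^ 2 * (p * (1 - p)) * ∑ b, lin v t b ^ 2) : ℝ) : ℂ)
      + ((-(2 * Real.pi * ∑ a, ((l a - p * ∑ b, (v b a : ℝ)) * t a)) : ℝ) : ℂ) * Complex.I := by
    push_cast; ring
  rw [gaussFn, h, Complex.exp_add, norm_mul, Complex.norm_exp_ofReal_mul_I, mul_one,
    ← Complex.ofReal_exp, Complex.norm_real, Real.norm_eq_abs, abs_of_pos (Real.exp_pos _)]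

lemma norm_fourierFn_sub_gaussFn_le {p ε η : ℝ} (h0 : 0 ≤ p) (h1 : p ≤ 1) (hε : ε ≤ 1 / 8)
    (hη : Real.pi ^ 2 * ε ^ 2 / 3 ≤ η) (hη1 : η ≤ 1) (v : B → A → ℤ) (l : A → ℤ) (t : A → ℝ)
    (ht : ∀ b, |lin v t b| ≤ ε) :
    ‖fourierFn v p l t - gaussFn v p l t‖ ≤ 200 * (p * (1 - p)) * (∑ b, |lin v t b| ^ 3) *
        Real.exp (-(2 * Real.pi ^ 2 * (1 - η) * (p * (1 - p)) * ∑ b, lin v t b ^ 2)) := by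
  refine le_trans (le_of_eq ?_)
    (norm_prod_bernChar_sub_gaussian_le h0 h1 hε hη hη1 (fun b => lin v t b) ht)
  set X : ℝ := ∑ a, ((l a - p * ∑ b, (v b a : ℝ) : ℝ) * t a) with hX
  have hsum : ∑ b, lin v t b = ∑ a, (∑ b, (v b a : ℝ)) * t a := by
    simp only [lin, Finset.sum_mul]
    rw [Finset.sum_comm]
    exact Finset.sum_congr rfl fun a _ => Finset.sum_congr rfl fun b _ => mul_comm _ _
  have hX' : X = ∑ a, (l a : ℝ) * t a - p * ∑ b, lin v t b := by
    rw [hX, hsum, Finset.mul_sum, ← Finset.sum_sub_distrib]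
    exact Finset.sum_congr rfl fun a _ => by ring
  have hF : fourierFn v p l t = Complex.exp (-(2 * Real.pi * Complex.I * X)) *
      ∏ b, bernChar p (lin v t b) * Complex.exp (-(2 * Real.pi * Complex.I * (p * lin v t b))) := by
    rw [Finset.prod_mul_distrib, ← Complex.exp_sum, mul_left_comm, ← Complex.exp_add, mul_comm,
      fourierFn]
    congr 2
    rw [hX']
    push_cast
    rw [Finset.sum_neg_distrib, ← Finset.mul_sum, ← Finset.mul_sum]
    ring
  have hG : gaussFn v p l t = Complex.exp (-(2 * Real.pi * Complex.I * X)) *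
      (Real.exp (-(2 * Real.pi ^ 2 * (p * (1 - p)) * ∑ b, lin v t b ^ 2)) : ℂ) := by
    rw [gaussFn, Complex.ofReal_exp, ← Complex.exp_add]
    congr 1
    rw [hX]
    push_cast
    ring
  rw [hF, hG, ← mul_sub, norm_mul]
  have : ‖Complex.exp (-(2 * Real.pi * Complex.I * X))‖ = 1 := by
    have h : (-(2 * Real.pi * Complex.I * X) : ℂ) = ((-(2 * Real.pi * X) : ℝ) : ℂ) * Complex.I := by
      push_cast; ring
    rw [h, Complex.norm_exp_ofReal_mul_I]
  rw [this, one_mul]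

lemma mul_sqrt_le_mul_exp {s : ℝ} (hs : 0 ≤ s) {d : ℝ} (hd : 0 < d) :
    s * √s ≤ d * √d * (2 * Real.exp (s / d)) := by
  have hz : 0 ≤ s / d := by positivity
  have h1 := Real.quadratic_le_exp_of_nonneg hz
  have h2 : s / d * √(s / d) ≤ 2 * Real.exp (s / d) := by
    have h3 : √(s / d) ≤ 1 + s / d := by
      rw [Real.sqrt_le_left (by linarith)]
      nlinarith
    nlinarith [mul_le_mul_of_nonneg_left h3 hz]
  have h4 : s * √s = d * √d * (s / d * √(s / d)) := by
    rw [Real.sqrt_div hs]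
    have : 0 < √d := Real.sqrt_pos.2 hd
    field_simp
  rw [h4]
  exact mul_le_mul_of_nonneg_left h2 (by positivity)

/-- The cubic error term. Since the phases satisfy `(lin v t b)² ≤ (d / N) Q` with `Q` the sum of
their squares, it is at most `√(d / (q N)) (q Q)^{3/2}`; the last factor is traded for `e^{qQ/d}`,
which changes the Gaussian integral in dimension `d` only by a bounded factor. -/
lemma cubic_error_le {p : ℝ} (h0 : 0 < p) (h1 : p < 1) {d : ℝ} (hd : 1 ≤ d) (x : B → ℝ)
    [Nonempty B] (hx : ∀ b, Fintype.card B * x b ^ 2 ≤ d * ∑ b, x b ^ 2) :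
    200 * (p * (1 - p)) * (∑ b, |x b| ^ 3) *
        Real.exp (-(2 * Real.pi ^ 2 * (1 - 1 / (8 * d)) * (p * (1 - p)) * ∑ b, x b ^ 2))
      ≤ 400 * d ^ 2 / √(p * (1 - p) * Fintype.card B) *
        Real.exp (-(2 * Real.pi ^ 2 * (1 - 1 / (2 * d)) * (p * (1 - p)) * ∑ b, x b ^ 2)) := by
  have hq : 0 < p * (1 - p) := mul_pos h0 (by linarith)
  have hN : (0 : ℝ) < Fintype.card B := by exact_mod_cast Fintype.card_pos
  obtain ⟨q, hqd⟩ : ∃ q, q = p * (1 - p) := ⟨_, rfl⟩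
  obtain ⟨N, hNd⟩ : ∃ N : ℝ, N = Fintype.card B := ⟨_, rfl⟩
  obtain ⟨Q, hQd⟩ : ∃ Q, Q = ∑ b, x b ^ 2 := ⟨_, rfl⟩
  rw [← hqd] at hq
  rw [← hNd] at hN
  rw [← hQd, ← hNd] at hx
  rw [← hqd, ← hNd, ← hQd]
  have hQ : 0 ≤ Q := hQd ▸ Finset.sum_nonneg fun _ _ => sq_nonneg _
  have h3 : ∑ b, |x b| ^ 3 ≤ √(d * Q / N) * Q := by
    have e : √(d * Q / N) * Q = ∑ b, √(d * Q / N) * x b ^ 2 := by rw [hQd, Finset.mul_sum]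
    rw [e]
    refine Finset.sum_le_sum fun b _ => ?_
    have : |x b| ≤ √(d * Q / N) := by
      refine Real.abs_le_sqrt ?_
      rw [le_div_iff₀ hN]
      linarith [hx b]
    calc |x b| ^ 3 = |x b| * x b ^ 2 := by rw [← sq_abs (x b)]; ring
      _ ≤ _ := mul_le_mul_of_nonneg_right this (sq_nonneg _)
  have h4 : q * (√(d * Q / N) * Q) = √d / √(q * N) * (q * Q * √(q * Q)) := by
    rw [Real.sqrt_div (by positivity), Real.sqrt_mul (by linarith), Real.sqrt_mul hq.le,
      Real.sqrt_mul hq.le]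
    have : 0 < √q := Real.sqrt_pos.2 hq
    have : 0 < √N := Real.sqrt_pos.2 hN
    field_simp
  have h5 := mul_sqrt_le_mul_exp (s := q * Q) (by positivity) (d := d) (by linarith)
  have hE0 := Real.exp_pos (-(2 * Real.pi ^ 2 * (1 - 1 / (8 * d)) * q * Q))
  have hsd : √d * √d = d := Real.mul_self_sqrt (by linarith)
  calc 200 * q * (∑ b, |x b| ^ 3) * Real.exp (-(2 * Real.pi ^ 2 * (1 - 1 / (8 * d)) * q * Q))
      ≤ 200 * (√d / √(q * N) * (d * √d * (2 * Real.exp (q * Q / d)))) *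
          Real.exp (-(2 * Real.pi ^ 2 * (1 - 1 / (8 * d)) * q * Q)) := by
        refine mul_le_mul_of_nonneg_right ?_ hE0.le
        have h6 := mul_le_mul_of_nonneg_left h3 hq.le
        rw [h4] at h6
        have h7 := mul_le_mul_of_nonneg_left h5 (by positivity : 0 ≤ √d / √(q * N))
        linarith
    _ = 400 * d ^ 2 / √(q * N) * (Real.exp (q * Q / d) *
          Real.exp (-(2 * Real.pi ^ 2 * (1 - 1 / (8 * d)) * q * Q))) := by
        have e : √d / √(q * N) * (d * √d * (2 * Real.exp (q * Q / d)))
          = 2 * d * (√d * √d) / √(q * N) * Real.exp (q * Q / d) := by ring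
        rw [e, hsd]
        ring
    _ ≤ _ := by
        refine mul_le_mul_of_nonneg_left ?_ (by positivity)
        rw [← Real.exp_add]
        refine Real.exp_le_exp.2 ?_
        have hpi : 9 ≤ Real.pi ^ 2 := by nlinarith [Real.pi_gt_three]
        have e : -(2 * Real.pi ^ 2 * (1 - 1 / (2 * d)) * q * Q)
            - (q * Q / d + -(2 * Real.pi ^ 2 * (1 - 1 / (8 * d)) * q * Q))
            = (3 / 4 * Real.pi ^ 2 - 1) * (q * Q / d) := by
          field_simp
          ring
        have : 0 ≤ (3 / 4 * Real.pi ^ 2 - 1) * (q * Q / d) :=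
          mul_nonneg (by linarith) (by positivity)
        linarith

end Comparison

section Core

variable {A B : Type*} [Fintype A] [Fintype B] [DecidableEq A]

/-- The Gaussian normalisation `(2π)^{-d/2} (det Σ)^{-1/2}`, where `Σ = p (1 - p) gram v`. -/
noncomputable def gaussNorm (v : B → A → ℤ) (p : ℝ) : ℝ :=
  (1 / (2 * Real.pi * (p * (1 - p)))) ^ ((Fintype.card A : ℝ) / 2) / √(gram v).det

namespace IsAdapted

variable {v : B → A → ℤ} {c₂ c₃ : ℕ}

lemma gaussNorm_pos (hv : IsAdapted v c₂ c₃) {p : ℝ} (h0 : 0 < p) (h1 : p < 1) :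
    0 < gaussNorm v p := by
  have hq : 0 < p * (1 - p) := mul_pos h0 (by linarith)
  have := hv.posDef_gram.det_pos
  unfold gaussNorm
  positivity

lemma gaussian_integral_lin (hv : IsAdapted v c₂ c₃) {p : ℝ} (h0 : 0 < p) (h1 : p < 1) {β : ℝ}
    (hβ : 0 < β) :
    Integrable (fun t : A → ℝ => Real.exp (-(β * (p * (1 - p)) * ∑ b, lin v t b ^ 2))) ∧
    ∫ t : A → ℝ, Real.exp (-(β * (p * (1 - p)) * ∑ b, lin v t b ^ 2))
      = (2 * Real.pi ^ 2 / β) ^ ((Fintype.card A : ℝ) / 2) * gaussNorm v p := by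
  have hq : 0 < p * (1 - p) := mul_pos h0 (by linarith)
  have h := gaussian_integral hv.posDef_gram (mul_pos hβ hq)
  simp only [dotProduct_gram_mulVec] at h
  refine ⟨h.1, h.2.trans ?_⟩
  rw [gaussNorm, ← mul_div_assoc, ← Real.mul_rpow (by positivity) (by positivity)]
  congr 2
  field_simp

lemma integral_gaussFn (hv : IsAdapted v c₂ c₃) {p : ℝ} (h0 : 0 < p) (h1 : p < 1) (l : A → ℤ)
    (x : A → ℝ) (hx : ∀ a, x a = l a - p * ∑ b, (v b a : ℝ)) :
    Integrable (gaussFn v p l) ∧ ∫ t, gaussFn v p l t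
      = ((gaussNorm v p *
        Real.exp (-(1 / 2) * (x ⬝ᵥ ((p * (1 - p)) • gram v)⁻¹ *ᵥ x)) : ℝ) : ℂ) := by
  have hq : 0 < p * (1 - p) := mul_pos h0 (by linarith)
  have h := gaussian_fourier hv.posDef_gram
    (mul_pos (by positivity : (0 : ℝ) < 2 * Real.pi ^ 2) hq) x
  simp only [dotProduct_gram_mulVec] at h
  have hunit : IsUnit (gram v).det := isUnit_iff_ne_zero.2 hv.posDef_gram.det_pos.ne'
  have e1 : ((p * (1 - p)) • gram v)⁻¹ = (p * (1 - p))⁻¹ • (gram v)⁻¹ := by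
    refine Matrix.inv_eq_right_inv ?_
    rw [Matrix.smul_mul, Matrix.mul_smul, smul_smul, mul_inv_cancel₀ hq.ne', one_smul,
      Matrix.mul_nonsing_inv _ hunit]
  have hx' : (fun a => (l a - p * ∑ b, (v b a : ℝ) : ℝ)) = x := funext fun a => (hx a).symm
  have hfn : gaussFn v p l = fun t : A → ℝ => Complex.exp
      (-((2 * Real.pi ^ 2 * (p * (1 - p)) * ∑ b, lin v t b ^ 2 : ℝ) : ℂ)
        - 2 * Real.pi * Complex.I * ∑ a, (x a * t a : ℂ)) := by
    rw [← hx']; rfl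
  rw [hfn]
  refine ⟨h.1, h.2.trans ?_⟩
  rw [e1, Matrix.smul_mulVec, dotProduct_smul, smul_eq_mul, gaussNorm]
  have hp1 : 1 - p ≠ 0 := by linarith
  have e2 : Real.pi / (2 * Real.pi ^ 2 * (p * (1 - p))) = 1 / (2 * Real.pi * (p * (1 - p))) := by
    field_simp
  have e3 : ∀ y : ℝ, -(Real.pi ^ 2 / (2 * Real.pi ^ 2 * (p * (1 - p)))) * y
      = -(1 / 2) * ((p * (1 - p))⁻¹ * y) := fun y => by
    field_simp
  rw [e2, e3]

/-- The contribution of the frequencies with small phases, compared with the Gaussian integral. -/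
lemma norm_integral_small_sub_le (hv : IsAdapted v c₂ c₃) (hc₃ : 1 ≤ c₃) [Nonempty A] {p : ℝ}
    (h0 : 0 < p) (h1 : p < 1) [Nonempty B] (l : A → ℤ)
    (hint : IntegrableOn (fourierFn v p l) (smallPhases v (1 / (2 * c₃)))) :
    ‖(∫ t in smallPhases v (1 / (2 * c₃)), fourierFn v p l t) - ∫ t, gaussFn v p l t‖
      ≤ gaussNorm v p * (800 * (Fintype.card A : ℝ) ^ 2 / √(p * (1 - p) * Fintype.card B)
        + 2 * 5 ^ ((Fintype.card A : ℝ) / 2) *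
          Real.exp (-(p * (1 - p) * Fintype.card B / (16 * Fintype.card A ^ 3 * c₃ ^ 2)))) := by
  have hq : 0 < p * (1 - p) := mul_pos h0 (by linarith)
  have hN : (0 : ℝ) < Fintype.card B := by exact_mod_cast Fintype.card_pos
  have hd : (1 : ℝ) ≤ Fintype.card A := by exact_mod_cast Fintype.card_pos (α := A)
  have hc : (1 : ℝ) ≤ c₃ := by exact_mod_cast hc₃
  have hZ := hv.gaussNorm_pos h0 h1
  have hG := (hv.integral_gaussFn h0 h1 l _ fun _ => rfl).1
  have hlev := hv.card_mul_sq_lin_le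
  obtain ⟨q, hqd⟩ : ∃ q, q = p * (1 - p) := ⟨_, rfl⟩
  obtain ⟨N, hNd⟩ : ∃ N : ℝ, N = Fintype.card B := ⟨_, rfl⟩
  obtain ⟨d, hdd⟩ : ∃ d : ℝ, d = Fintype.card A := ⟨_, rfl⟩
  rw [← hqd] at hq
  rw [← hNd] at hN
  rw [← hdd] at hd
  let Q : (A → ℝ) → ℝ := fun t => ∑ b, lin v t b ^ 2
  have hQ0 : ∀ t, 0 ≤ Q t := fun t => Finset.sum_nonneg fun _ _ => sq_nonneg _
  have hQc : Continuous Q := continuous_finsetSum _ fun b _ => (continuous_lin v b).pow 2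
  -- The threshold is chosen such that all phases are at most `ε = 1 / (8 d c₃)` in the near region.
  let w : ℝ := q * N / (64 * d ^ 3 * c₃ ^ 2)
  let near : Set (A → ℝ) := {t | q * Q t ≤ w}
  have hnear_meas : MeasurableSet near :=
    (isClosed_le (continuous_const.mul hQc) continuous_const).measurableSet
  have hphase : ∀ t ∈ near, ∀ b, |lin v t b| ≤ 1 / (8 * d * c₃) := by
    intro t ht b
    refine abs_le_of_sq_le_sq ?_ (by positivity)
    have h2 := hlev t b
    rw [← hNd, ← hdd] at h2
    have h3 : q * Q t ≤ q * N / (64 * d ^ 3 * c₃ ^ 2) := ht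
    have h4 : Q t ≤ N / (64 * d ^ 3 * c₃ ^ 2) := by
      rw [mul_div_assoc] at h3
      exact le_of_mul_le_mul_left h3 hq
    have h5 : N * lin v t b ^ 2 ≤ N * (1 / (8 * d * c₃)) ^ 2 := by
      refine h2.trans ((mul_le_mul_of_nonneg_left h4 (by linarith)).trans (le_of_eq ?_))
      field_simp
      norm_num
    exact le_of_mul_le_mul_left h5 hN
  have hsub : near ⊆ smallPhases v (1 / (2 * c₃)) := by
    intro t ht b
    refine (hphase t ht b).trans_lt ?_
    rw [div_lt_div_iff₀ (by positivity) (by positivity)]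
    nlinarith
  have hβ : (0 : ℝ) < 2 * Real.pi ^ 2 * (1 - 1 / (2 * d)) := by
    have : 1 / (2 * d) ≤ 1 / 2 := by
      rw [div_le_div_iff₀ (by positivity) (by norm_num)]; linarith
    have : 0 < 1 - 1 / (2 * d) := by linarith
    positivity
  have hI1 := hv.gaussian_integral_lin h0 h1 hβ
  have hI2 := hv.gaussian_integral_lin h0 h1 (by norm_num : (0 : ℝ) < 4)
  rw [← hqd, ← hdd] at hI1 hI2
  -- Near the origin the Taylor comparison applies, with a loss `1 - 1 / (2 d)` in the exponent.
  have hA : ‖∫ t in near, (fourierFn v p l t - gaussFn v p l t)‖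
      ≤ gaussNorm v p * (800 * d ^ 2 / √(q * N)) := by
    have hpt : ∀ t ∈ near, ‖fourierFn v p l t - gaussFn v p l t‖ ≤ 400 * d ^ 2 / √(q * N) *
        Real.exp (-(2 * Real.pi ^ 2 * (1 - 1 / (2 * d)) * q * Q t)) := by
      intro t ht
      have hε : 1 / (8 * d * c₃) ≤ 1 / (8 * d) := by
        refine div_le_div_of_nonneg_left zero_le_one (by positivity) ?_
        nlinarith
      have hε8 : 1 / (8 * d) ≤ 1 / 8 := by
        rw [div_le_div_iff₀ (by positivity) (by norm_num)]; linarith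
      have hη : Real.pi ^ 2 * (1 / (8 * d * c₃)) ^ 2 / 3 ≤ 1 / (8 * d) := by
        have h2 : (1 / (8 * d * c₃)) ^ 2 ≤ (1 / (8 * d)) * (1 / 8) := by
          rw [sq]
          exact mul_le_mul hε (hε.trans hε8) (by positivity) (by positivity)
        have h3 : Real.pi ^ 2 ≤ 10 := by nlinarith [Real.pi_pos, Real.pi_lt_d2]
        have h4 : 0 ≤ (1 / (8 * d * c₃)) ^ 2 := by positivity
        have h5 : 0 ≤ 1 / (8 * d) := by positivity
        nlinarith
      refine (norm_fourierFn_sub_gaussFn_le h0.le h1.le (hε.trans hε8) hη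
        (hε8.trans (by norm_num)) v l t (hphase t ht)).trans ?_
      have := cubic_error_le h0 h1 hd (fun b => lin v t b) (fun b => by
        have := hlev t b
        rwa [← hdd] at this)
      rw [← hqd, ← hNd] at this
      rw [← hqd]
      exact this
    refine (norm_integral_le_of_norm_le ((hI1.1.const_mul _).integrableOn (s := near))
      ((ae_restrict_iff' hnear_meas).2 (Filter.Eventually.of_forall hpt))).trans ?_
    refine (setIntegral_le_integral (hI1.1.const_mul _)
      (Filter.Eventually.of_forall fun t => by positivity)).trans ?_
    rw [integral_const_mul, hI1.2]
    -- Bernoulli's inequality: `(1 - 1 / (2 d)) ^ d ≥ 1 / 2`.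
    have hfac : (2 * Real.pi ^ 2 / (2 * Real.pi ^ 2 * (1 - 1 / (2 * d)))) ^ (d / 2) ≤ 2 := by
      have hpi2 : (0 : ℝ) < 2 * Real.pi ^ 2 := by positivity
      have hpos : 0 < 1 - 1 / (2 * d) := by
        rcases (mul_pos_iff_of_pos_left hpi2).1 hβ with h; exact h
      rw [← div_div, div_self hpi2.ne', one_div, Real.inv_rpow hpos.le]
      refine inv_le_of_inv_le₀ (by norm_num) ?_
      have hb := one_add_mul_self_le_rpow_one_add (s := -(1 / (2 * d))) (p := d)
        (by linarith) hd
      have e : 1 + d * -(1 / (2 * d)) = 1 / 2 := by field_simp; norm_num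
      rw [e, ← sub_eq_add_neg] at hb
      have h1' : (1 - 1 / (2 * d)) ≤ 1 := by
        have : 0 ≤ 1 / (2 * d) := by positivity
        linarith
      have := Real.rpow_le_rpow_of_exponent_ge hpos h1' (by linarith : d / 2 ≤ d)
      linarith
    calc _ ≤ 400 * d ^ 2 / √(q * N) * (2 * gaussNorm v p) := by
          refine mul_le_mul_of_nonneg_left ?_ (by positivity)
          exact mul_le_mul_of_nonneg_right hfac hZ.le
      _ = _ := by ring
  -- Outside, half of the exponent `8 q Q` gives the small factor, the other half the integral.
  have htail : ∀ (f : (A → ℝ) → ℂ) (s : Set (A → ℝ)), MeasurableSet s →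
      (∀ t ∈ s, ‖f t‖ ≤ Real.exp (-(8 * q * Q t)) ∧ w ≤ q * Q t) →
      ‖∫ t in s, f t‖ ≤ gaussNorm v p * (5 ^ (d / 2) *
        Real.exp (-(q * N / (16 * d ^ 3 * c₃ ^ 2)))) := by
    intro f s hs hf
    have hpt : ∀ t ∈ s, ‖f t‖ ≤ Real.exp (-(4 * w)) * Real.exp (-(4 * q * Q t)) := by
      intro t ht
      obtain ⟨h2, h3⟩ := hf t ht
      refine h2.trans ?_
      rw [← Real.exp_add]
      exact Real.exp_le_exp.2 (by linarith)
    refine (norm_integral_le_of_norm_le ((hI2.1.const_mul _).integrableOn (s := s))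
      ((ae_restrict_iff' hs).2 (Filter.Eventually.of_forall hpt))).trans ?_
    refine (setIntegral_le_integral (hI2.1.const_mul _)
      (Filter.Eventually.of_forall fun t => by positivity)).trans ?_
    rw [integral_const_mul, hI2.2]
    have hw : 4 * w = q * N / (16 * d ^ 3 * c₃ ^ 2) := by
      simp only [w]; field_simp; norm_num
    rw [hw]
    have h5 : (2 * Real.pi ^ 2 / 4) ^ (d / 2) ≤ (5 : ℝ) ^ (d / 2) := by
      refine Real.rpow_le_rpow (by positivity) ?_ (by positivity)
      nlinarith [Real.pi_pos, Real.pi_lt_d2]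
    calc _ ≤ Real.exp (-(q * N / (16 * d ^ 3 * c₃ ^ 2))) * (5 ^ (d / 2) * gaussNorm v p) := by
          refine mul_le_mul_of_nonneg_left ?_ (Real.exp_pos _).le
          exact mul_le_mul_of_nonneg_right h5 hZ.le
      _ = _ := by ring
  have hsmall := measurableSet_smallPhases v (1 / (2 * (c₃ : ℝ)))
  have hB := htail (fourierFn v p l) (smallPhases v (1 / (2 * c₃)) \ near)
    (hsmall.diff hnear_meas) (fun t ht => ⟨by
      refine (norm_fourierFn_le h0.le h1.le v l t).trans (le_of_eq ?_)
      rw [← hqd]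
      congr 3
      refine Finset.sum_congr rfl fun b _ => ?_
      have h2 : |lin v t b| < 1 / 2 := (ht.1 b).trans_le (by
        rw [div_le_div_iff₀ (by positivity) (by norm_num)]; linarith)
      have h3 : round (lin v t b) = 0 := by
        rw [abs_lt] at h2
        rw [round_eq_zero_iff]
        exact ⟨by linarith [h2.1], h2.2⟩
      rw [h3, Int.cast_zero, sub_zero], (not_le.1 ht.2).le⟩)
  have hC := htail (gaussFn v p l) nearᶜ hnear_meas.compl (fun t ht => ⟨by
      rw [norm_gaussFn, ← hqd]
      refine Real.exp_le_exp.2 (neg_le_neg ?_)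
      have : (8 : ℝ) ≤ 2 * Real.pi ^ 2 := by nlinarith [Real.pi_gt_three]
      exact mul_le_mul_of_nonneg_right (mul_le_mul_of_nonneg_right this hq.le) (hQ0 t),
      (not_le.1 (show ¬ q * Q t ≤ w from ht)).le⟩)
  have hsplit : (∫ t in smallPhases v (1 / (2 * c₃)), fourierFn v p l t) - ∫ t, gaussFn v p l t
      = (∫ t in near, (fourierFn v p l t - gaussFn v p l t))
        + (∫ t in smallPhases v (1 / (2 * c₃)) \ near, fourierFn v p l t)
        - ∫ t in nearᶜ, gaussFn v p l t := by
    rw [integral_sub (hint.mono_set hsub) hG.integrableOn, ← integral_add_compl hnear_meas hG]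
    have : ∫ t in smallPhases v (1 / (2 * c₃)), fourierFn v p l t
        = (∫ t in near, fourierFn v p l t)
          + ∫ t in smallPhases v (1 / (2 * c₃)) \ near, fourierFn v p l t := by
      rw [← integral_inter_add_sdiff hnear_meas hint, Set.inter_eq_right.2 hsub]
    rw [this]
    ring
  rw [hsplit]
  refine (norm_sub_le _ _).trans ?_
  refine (add_le_add_left (norm_add_le _ _) _).trans ?_
  rw [← hqd, ← hNd, ← hdd]
  calc _ ≤ gaussNorm v p * (800 * d ^ 2 / √(q * N)) +
        gaussNorm v p * (5 ^ (d / 2) * Real.exp (-(q * N / (16 * d ^ 3 * c₃ ^ 2)))) +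
        gaussNorm v p * (5 ^ (d / 2) * Real.exp (-(q * N / (16 * d ^ 3 * c₃ ^ 2)))) :=
      add_le_add (add_le_add hA hB) hC
    _ = _ := by ring

/-- The local limit theorem with an explicit error, in coordinates adapted to the lattice. -/
lemma abs_pointProb_sub_le (hv : IsAdapted v c₂ c₃) (hc₃ : 1 ≤ c₃) [Nonempty A] [DecidableEq B]
    {p : ℝ} (h0 : 0 < p) (h1 : p < 1) [Nonempty B] (l : A → ℤ)
    (x : A → ℝ) (hx : ∀ a, x a = l a - p * ∑ b, (v b a : ℝ)) {K : ℝ}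
    (hK : ∀ J : ℕ, 2 ^ J ≤ (2 * J * c₂ + 1) ^ Fintype.card A → (J : ℝ) ≤ K) (hK0 : 0 < K) :
    |pointProb v p l - gaussNorm v p *
        Real.exp (-(1 / 2) * (x ⬝ᵥ ((p * (1 - p)) • gram v)⁻¹ *ᵥ x))|
      ≤ gaussNorm v p * (800 * (Fintype.card A : ℝ) ^ 2 / √(p * (1 - p) * Fintype.card B)
        + 2 * 5 ^ ((Fintype.card A : ℝ) / 2) *
          Real.exp (-(p * (1 - p) * Fintype.card B / (16 * Fintype.card A ^ 3 * c₃ ^ 2)))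
        + (2 * Real.pi * c₂ ^ 2 * (p * (1 - p) * Fintype.card B)) ^ ((Fintype.card A : ℝ) / 2) *
          Real.exp (-(2 * (p * (1 - p) * Fintype.card B) / (c₃ ^ 2 * K ^ 2)))) := by
  have hq : 0 < p * (1 - p) := mul_pos h0 (by linarith)
  obtain ⟨hint, hP⟩ := hv.pointProb_eq hc₃ h0.le h1.le l
  have hZ := hv.gaussNorm_pos h0 h1
  have hS := hv.norm_integral_small_sub_le hc₃ h0 h1 l hint
  have hF := hv.norm_integral_far_le hc₃ h0.le h1.le l hK hK0
  have hG := (hv.integral_gaussFn h0 h1 l x hx).2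
  rw [hG] at hS
  -- The determinant bound turns an absolute error into one relative to `gaussNorm`.
  have hone : 1 ≤ gaussNorm v p *
      (2 * Real.pi * c₂ ^ 2 * (p * (1 - p) * Fintype.card B)) ^ ((Fintype.card A : ℝ) / 2) := by
    have hdet := hv.det_gram_le
    have hdet0 := hv.posDef_gram.det_pos
    rw [gaussNorm, div_mul_eq_mul_div, ← Real.mul_rpow (by positivity) (by positivity),
      one_le_div (Real.sqrt_pos.2 hdet0)]
    have e : 1 / (2 * Real.pi * (p * (1 - p))) *
        (2 * Real.pi * c₂ ^ 2 * (p * (1 - p) * Fintype.card B)) = c₂ ^ 2 * Fintype.card B := by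
      have h2 : 1 - p ≠ 0 := by linarith
      field_simp
    rw [e]
    refine (Real.sqrt_le_sqrt hdet).trans (le_of_eq ?_)
    rw [Real.sqrt_eq_rpow, ← Real.rpow_natCast, ← Real.rpow_mul (by positivity)]
    congr 1
    ring
  rw [← Real.norm_eq_abs, ← Complex.norm_real, Complex.ofReal_sub, hP, add_sub_right_comm]
  refine (norm_add_le _ _).trans ((add_le_add hS hF).trans ?_)
  have hE := Real.exp_pos (-(2 * (p * (1 - p) * Fintype.card B) / (c₃ ^ 2 * K ^ 2)))
  nlinarith [mul_le_mul_of_nonneg_right hone hE.le]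

end IsAdapted

end Core

end LCLT

namespace LCLT

/-! ### Numerical estimates -/

lemma log_two_mul_ge {c d : ℝ} (hc : 1 ≤ c) (hd : 1 ≤ d) : 69 / 100 ≤ Real.log (2 * c * d) := by
  have h1 : (1 : ℝ) ≤ c * d := one_le_mul_of_one_le_of_one_le hc hd
  have := Real.log_le_log (by norm_num) (by linarith : (2 : ℝ) ≤ 2 * c * d)
  linarith [Real.log_two_gt_d9]

lemma log_sq_le {z : ℝ} (hz : 1 ≤ z) : Real.log z ^ 2 ≤ 16 * √z := by
  have h0 : 0 ≤ Real.log z := Real.log_nonneg hz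
  have h1 : Real.log z ≤ 4 * √(√z) := by
    have h2 := Real.log_le_sub_one_of_pos (x := √(√z)) (by positivity)
    rw [Real.log_sqrt (by positivity), Real.log_sqrt (by positivity)] at h2
    linarith
  calc Real.log z ^ 2 ≤ (4 * √(√z)) ^ 2 := pow_le_pow_left₀ h0 h1 2
    _ = 16 * √z := by rw [mul_pow, Real.sq_sqrt (Real.sqrt_nonneg _)]; norm_num

/-- The size condition of the local limit theorem, in terms of `T = √(q N) / c₃`. -/
lemma sqrt_size_le {c₂ c₃ d y : ℝ} (hc₂ : 1 ≤ c₂) (hc₃ : 1 ≤ c₃) (hd : 1 ≤ d)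
    (hy : 10 ^ 8 * c₂ * c₃ ^ 2 * d ^ 6 * Real.log (2 * c₃ * d) ^ 6 ≤ y) :
    10 ^ 4 * √c₂ * d ^ 3 * Real.log (2 * c₃ * d) ^ 3 ≤ √y / c₃ := by
  have hl := log_two_mul_ge hc₃ hd
  rw [le_div_iff₀ (by linarith)]
  refine Real.le_sqrt_of_sq_le (le_trans (le_of_eq ?_) hy)
  have : √c₂ ^ 2 = c₂ := Real.sq_sqrt (by linarith)
  calc _ = 10 ^ 8 * √c₂ ^ 2 * c₃ ^ 2 * d ^ 6 * Real.log (2 * c₃ * d) ^ 6 := by ring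
    _ = _ := by rw [this]

section

-- In this section `s = √c₂`, `L = log (2 c₃ d)` and `T = √(q N) / c₃`.
variable {s d L T : ℝ}

lemma size_consequences (hs : 1 ≤ s) (hd : 1 ≤ d) (hL : 69 / 100 ≤ L)
    (hT : 10 ^ 4 * s * d ^ 3 * L ^ 3 ≤ T) :
    1000 * d * L ≤ T ∧ 1000 * d * s ≤ T ∧ d ^ 2 ≤ T := by
  have hL3 : (3 : ℝ) / 10 ≤ L ^ 3 := by
    have := pow_le_pow_left₀ (by norm_num) hL 3
    norm_num at this ⊢
    linarith
  have hL2 : (3 : ℝ) / 10 ≤ L ^ 2 := by nlinarith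
  have hd2 : 1 ≤ d ^ 2 := one_le_pow₀ hd
  have hd3 : d ≤ d ^ 3 := by nlinarith
  have hd23 : d ^ 2 ≤ d ^ 3 := by nlinarith
  have h1 : 10 ^ 4 * s * d ^ 3 * (3 / 10) ≤ T := le_trans (by gcongr) hT
  have h2 : 10 ^ 4 * 1 * d * (3 / 10 * L) ≤ T := by
    refine le_trans ?_ hT
    have : 3 / 10 * L ≤ L ^ 3 := by nlinarith
    gcongr
  refine ⟨by nlinarith, ?_, ?_⟩
  · nlinarith [mul_le_mul_of_nonneg_left hd3 (by linarith : 0 ≤ s)]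
  · nlinarith [mul_le_mul_of_nonneg_right hs (by positivity : 0 ≤ d ^ 3)]

lemma tail_exponent_le (hs : 1 ≤ s) (hd : 1 ≤ d) (hL : 69 / 100 ≤ L)
    (hT : 10 ^ 4 * s * d ^ 3 * L ^ 3 ≤ T) :
    d + Real.log T + L ≤ T ^ 2 / (16 * d ^ 3) := by
  obtain ⟨h1, h2, -⟩ := size_consequences hs hd hL hT
  have hT0 : 0 < T := lt_of_lt_of_le (by positivity) hT
  have hlog : Real.log T ≤ T := (Real.log_le_sub_one_of_pos hT0).trans (by linarith)
  have hL3 : (3 : ℝ) / 10 ≤ L ^ 3 := by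
    have := pow_le_pow_left₀ (by norm_num) hL 3
    norm_num at this ⊢
    linarith
  have h3 : 10 ^ 4 * 1 * d ^ 3 * (3 / 10) ≤ T := le_trans (by gcongr) hT
  rw [le_div_iff₀ (by positivity)]
  have h4 : d + Real.log T + L ≤ 3 * T := by nlinarith
  calc (d + Real.log T + L) * (16 * d ^ 3) ≤ 3 * T * (16 * d ^ 3) :=
        mul_le_mul_of_nonneg_right h4 (by positivity)
    _ ≤ T * T := by nlinarith
    _ = T ^ 2 := by ring

lemma far_exponent_bound {l₂ : ℝ} (hs : 1 ≤ s) (hd : 1 ≤ d) (hL : 69 / 100 ≤ L)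
    (hT : 10 ^ 4 * s * d ^ 3 * L ^ 3 ≤ T) (hl₂ : 0 < l₂) (hl₂s : l₂ ^ 2 ≤ 24 * s * d) :
    d * (2 + 4 * Real.log s + 2 * Real.log T + 2 * L) ≤ T ^ 2 / (18 * d ^ 2 * l₂ ^ 2) := by
  obtain ⟨h1, h2, h3⟩ := size_consequences hs hd hL hT
  have hT0 : 0 < T := lt_of_lt_of_le (by positivity) hT
  have hlogT : Real.log T ≤ 2 * √T := by
    have := Real.log_le_sub_one_of_pos (x := √T) (by positivity)
    rw [Real.log_sqrt hT0.le] at this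
    linarith
  have hdT : d ≤ √T := Real.le_sqrt_of_sq_le h3
  have hlogs : Real.log s ≤ s := (Real.log_le_sub_one_of_pos (by linarith)).trans (by linarith)
  have hTT : √T * √T = T := Real.mul_self_sqrt hT0.le
  have h4 : d * Real.log T ≤ 2 * T := by
    have e1 : d * Real.log T ≤ d * (2 * √T) := mul_le_mul_of_nonneg_left hlogT (by linarith)
    have e2 : d * (2 * √T) ≤ √T * (2 * √T) := mul_le_mul_of_nonneg_right hdT (by positivity)
    linarith
  have h5 : d * Real.log s ≤ d * s := mul_le_mul_of_nonneg_left hlogs (by linarith)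
  have hL3 : (32 : ℝ) / 100 ≤ L ^ 3 := by
    have := pow_le_pow_left₀ (by norm_num) hL 3
    norm_num at this ⊢
    linarith
  have h7 : 10 ^ 4 * s * d ^ 3 * (32 / 100) ≤ T := le_trans (by gcongr) hT
  have h8 : d * (2 + 4 * Real.log s + 2 * Real.log T + 2 * L) ≤ 5 * T := by nlinarith
  rw [le_div_iff₀ (by positivity)]
  calc d * (2 + 4 * Real.log s + 2 * Real.log T + 2 * L) * (18 * d ^ 2 * l₂ ^ 2)
      ≤ 5 * T * (18 * d ^ 2 * (24 * s * d)) := by gcongr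
    _ = T * (2160 * s * d ^ 3) := by ring
    _ ≤ T * T := by
        refine mul_le_mul_of_nonneg_left (le_trans ?_ h7) hT0.le
        have : 0 ≤ s * d ^ 3 := by positivity
        linarith
    _ = T ^ 2 := by ring

end

/-- The Gaussian tails are negligible. -/
lemma tail_term_le {c₂ c₃ d y : ℝ} (hc₂ : 1 ≤ c₂) (hc₃ : 1 ≤ c₃) (hd : 1 ≤ d)
    (hy : 10 ^ 8 * c₂ * c₃ ^ 2 * d ^ 6 * Real.log (2 * c₃ * d) ^ 6 ≤ y) :
    5 ^ (d / 2) * Real.exp (-(y / (16 * d ^ 3 * c₃ ^ 2))) ≤ 1 / √y := by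
  have hL := log_two_mul_ge hc₃ hd
  have hT := sqrt_size_le hc₂ hc₃ hd hy
  have hs : 1 ≤ √c₂ := Real.one_le_sqrt.2 hc₂
  have hy0 : 0 < y := lt_of_lt_of_le (by positivity) hy
  have hsy : 0 < √y := Real.sqrt_pos.2 hy0
  have hT0 : 0 < √y / c₃ := by positivity
  have hlogc : Real.log c₃ ≤ Real.log (2 * c₃ * d) :=
    Real.log_le_log (by linarith) (by nlinarith)
  have hlogsy : Real.log (√y) = Real.log (√y / c₃) + Real.log c₃ := by
    rw [← Real.log_mul hT0.ne' (by linarith)]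
    congr 1
    field_simp
  have h := tail_exponent_le hs hd hL hT
  have e : (√y / c₃) ^ 2 / (16 * d ^ 3) = y / (16 * d ^ 3 * c₃ ^ 2) := by
    rw [div_pow, Real.sq_sqrt hy0.le]; field_simp
  rw [e] at h
  have h5 : Real.log 5 ≤ 2 := by
    rw [Real.log_le_iff_le_exp (by norm_num)]
    have := Real.quadratic_le_exp_of_nonneg (x := 2) (by norm_num)
    linarith
  rw [Real.rpow_def_of_pos (by norm_num), ← Real.exp_add, one_div,
    ← Real.exp_log hsy, ← Real.exp_neg]
  refine Real.exp_le_exp.2 ?_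
  have : Real.log 5 * (d / 2) ≤ 2 * (d / 2) := mul_le_mul_of_nonneg_right h5 (by linarith)
  linarith

/-- The frequencies far from the dual lattice are negligible. -/
lemma far_term_le {c₂ c₃ d y : ℝ} (hc₂ : 1 ≤ c₂) (hc₃ : 1 ≤ c₃) (hd : 1 ≤ d)
    (hy : 10 ^ 8 * c₂ * c₃ ^ 2 * d ^ 6 * Real.log (2 * c₃ * d) ^ 6 ≤ y) :
    (2 * Real.pi * c₂ ^ 2 * y) ^ (d / 2) *
        Real.exp (-(2 * y / (c₃ ^ 2 * (6 * d * Real.log (2 * c₂ * d)) ^ 2))) ≤ 1 / √y := by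
  have hL := log_two_mul_ge hc₃ hd
  have hT := sqrt_size_le hc₂ hc₃ hd hy
  have hs : 1 ≤ √c₂ := Real.one_le_sqrt.2 hc₂
  have hy0 : 0 < y := lt_of_lt_of_le (by positivity) hy
  have hsy : 0 < √y := Real.sqrt_pos.2 hy0
  have hT0 : 0 < √y / c₃ := by positivity
  have hlogc : Real.log c₃ ≤ Real.log (2 * c₃ * d) :=
    Real.log_le_log (by linarith) (by nlinarith)
  have hlogsy : Real.log (√y) = Real.log (√y / c₃) + Real.log c₃ := by
    rw [← Real.log_mul hT0.ne' (by linarith)]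
    congr 1
    field_simp
  have hl₂ := log_two_mul_ge hc₂ hd
  have hcd : 1 ≤ c₂ * d := one_le_mul_of_one_le_of_one_le hc₂ hd
  have hls : Real.log (2 * c₂ * d) ^ 2 ≤ 24 * √c₂ * d := by
    refine (log_sq_le (by linarith)).trans ?_
    have : √(2 * c₂ * d) ≤ 3 / 2 * √c₂ * d := by
      refine Real.sqrt_le_iff.2 ⟨by positivity, ?_⟩
      rw [mul_pow, mul_pow, Real.sq_sqrt (by linarith)]
      nlinarith [mul_nonneg (by linarith : 0 ≤ c₂) (by nlinarith : 0 ≤ d ^ 2 - d)]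
    linarith
  have h := far_exponent_bound hs hd hL hT (by linarith) hls
  have e : (√y / c₃) ^ 2 / (18 * d ^ 2 * Real.log (2 * c₂ * d) ^ 2)
      = 2 * y / (c₃ ^ 2 * (6 * d * Real.log (2 * c₂ * d)) ^ 2) := by
    have : Real.log (2 * c₂ * d) ≠ 0 := by linarith
    rw [div_pow, Real.sq_sqrt hy0.le]
    field_simp
    norm_num
  rw [e] at h
  have hπ : Real.log (2 * Real.pi) ≤ 2 := by
    rw [Real.log_le_iff_le_exp (by positivity)]
    have h2 : Real.exp 2 = Real.exp 1 * Real.exp 1 := by rw [← Real.exp_add]; norm_num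
    have := Real.exp_one_gt_d9
    rw [h2]
    nlinarith [Real.pi_lt_d2]
  have hlogy : Real.log y = 2 * Real.log (√y) := by rw [Real.log_sqrt hy0.le]; ring
  have hlc : Real.log c₂ = 2 * Real.log (√c₂) := by rw [Real.log_sqrt (by linarith)]; ring
  have hlog : Real.log (2 * Real.pi * c₂ ^ 2 * y)
      = Real.log (2 * Real.pi) + 4 * Real.log (√c₂) + 2 * Real.log (√y) := by
    rw [Real.log_mul (by positivity) hy0.ne', Real.log_mul (by positivity) (by positivity),
      Real.log_pow, hlc, hlogy]
    push_cast
    ring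
  have hs0 : 0 ≤ Real.log (√c₂) := Real.log_nonneg hs
  have hdT := (size_consequences hs hd hL hT).2.2
  have hT1 : 0 ≤ Real.log (√y / c₃) := Real.log_nonneg (by nlinarith)
  have hy1 : 0 ≤ Real.log (√y) := by rw [hlogsy]; linarith [Real.log_nonneg hc₃]
  rw [Real.rpow_def_of_pos (by positivity), ← Real.exp_add, one_div,
    ← Real.exp_log hsy, ← Real.exp_neg, hlog]
  refine Real.exp_le_exp.2 ?_
  have h6 : (Real.log (2 * Real.pi) + 4 * Real.log (√c₂) + 2 * Real.log (√y)) * (d / 2)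
      + Real.log (√y) ≤ d * (2 + 4 * Real.log (√c₂) + 2 * Real.log (√y)) := by
    nlinarith [mul_nonneg hs0 (by linarith : 0 ≤ d), mul_le_mul_of_nonneg_right hd hy1]
  have h7 : d * (2 + 4 * Real.log (√c₂) + 2 * Real.log (√y)) ≤
      d * (2 + 4 * Real.log (√c₂) + 2 * Real.log (√y / c₃) + 2 * Real.log (2 * c₃ * d)) := by
    refine mul_le_mul_of_nonneg_left ?_ (by linarith)
    linarith
  linarith

/-- The three error terms of the local limit theorem are dominated by the claimed bound. -/
lemma total_error_le {c₂ c₃ d y x : ℝ} (hc₂ : 1 ≤ c₂) (hc₃ : 1 ≤ c₃) (hd : 1 ≤ d) (hx0 : 0 < x)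
    (hxy : x ≤ 2 * y)
    (hx : 2 * 10 ^ 8 * c₂ * c₃ ^ 2 * d ^ 6 * Real.log (2 * c₃ * d) ^ 6 ≤ x) :
    800 * d ^ 2 / √y + 2 * 5 ^ (d / 2) * Real.exp (-(y / (16 * d ^ 3 * c₃ ^ 2)))
      + (2 * Real.pi * c₂ ^ 2 * y) ^ (d / 2) *
        Real.exp (-(2 * y / (c₃ ^ 2 * (6 * d * Real.log (2 * c₂ * d)) ^ 2)))
      ≤ 2 * 10 ^ 8 * d ^ 3 * Real.log (2 * c₂ * d) ^ (3 / 2 : ℝ) / √x := by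
  have hy0 : 0 < y := by linarith
  have hl₂ := log_two_mul_ge hc₂ hd
  have hsy : 0 < √y := Real.sqrt_pos.2 hy0
  have hE1 := tail_term_le hc₂ hc₃ hd (y := y) (by linarith)
  have hE2 := far_term_le hc₂ hc₃ hd (y := y) (by linarith)
  have hl32 : 4 / 10 ≤ Real.log (2 * c₂ * d) ^ (3 / 2 : ℝ) := by
    have h1 : (69 / 100 : ℝ) ^ (3 / 2 : ℝ) ≤ Real.log (2 * c₂ * d) ^ (3 / 2 : ℝ) :=
      Real.rpow_le_rpow (by norm_num) hl₂ (by norm_num)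
    have h2 : (69 / 100 : ℝ) ^ (2 : ℝ) ≤ (69 / 100 : ℝ) ^ (3 / 2 : ℝ) :=
      Real.rpow_le_rpow_of_exponent_ge (by norm_num) (by norm_num) (by norm_num)
    have h3 : (69 / 100 : ℝ) ^ (2 : ℝ) = 4761 / 10000 := by
      rw [show (2 : ℝ) = ((2 : ℕ) : ℝ) by norm_num, Real.rpow_natCast]; norm_num
    linarith
  have hd23 : d ^ 2 ≤ d ^ 3 := by nlinarith [sq_nonneg d]
  have hd3 : 1 ≤ d ^ 3 := one_le_pow₀ hd
  have hinv : 1 / √y ≤ 2 / √x := by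
    rw [div_le_div_iff₀ hsy (Real.sqrt_pos.2 hx0), one_mul]
    refine Real.sqrt_le_iff.2 ⟨by positivity, ?_⟩
    rw [mul_pow, Real.sq_sqrt hy0.le]
    linarith
  calc _ ≤ 800 * d ^ 2 * (1 / √y) + 2 * (1 / √y) + 1 / √y := by
        rw [mul_assoc 2 (_ : ℝ) (Real.exp _), mul_one_div]
        exact add_le_add (add_le_add le_rfl (by linarith)) hE2
    _ = (800 * d ^ 2 + 3) * (1 / √y) := by ring
    _ ≤ (800 * d ^ 3 + 3 * d ^ 3) * (2 / √x) := by gcongr; linarith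
    _ = 1606 * d ^ 3 / √x := by ring
    _ ≤ _ := by
        refine div_le_div_of_nonneg_right ?_ (Real.sqrt_nonneg _)
        calc 1606 * d ^ 3 ≤ 2 * 10 ^ 8 * d ^ 3 * (4 / 10) := by linarith
          _ ≤ _ := mul_le_mul_of_nonneg_left hl32 (by positivity)

end LCLT

namespace LCLT

/-! ### Coordinates adapted to the lattice -/

section Adapted

variable {A B : Type*} [Fintype A] {V : Submodule ℚ (B → ℚ)}

lemma span_range_basisMap (φ : Module.Basis A ℚ V) :
    Submodule.span ℚ (Set.range (basisMap φ)) = ⊤ := by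
  classical
  by_contra hne
  obtain ⟨f, hf, hker⟩ := Submodule.exists_le_ker_of_lt_top _ (lt_top_iff_ne_top.2 hne)
  have hfx : ∀ x : A → ℚ, f x = ∑ a, x a * f (Pi.single a 1) := fun x => by
    conv_lhs => rw [← Finset.univ_sum_single x]
    rw [map_sum]
    refine Finset.sum_congr rfl fun a _ => ?_
    rw [← smul_eq_mul, ← map_smul, ← Pi.single_smul, smul_eq_mul, mul_one]
  have h0 : ∑ a, f (Pi.single a 1) • φ a = 0 := by
    refine Subtype.ext (funext fun b => ?_)
    have h1 : f (basisMap φ b) = 0 := hker (Submodule.subset_span ⟨b, rfl⟩)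
    rw [hfx] at h1
    simp only [Submodule.coe_sum, Submodule.coe_smul, Finset.sum_apply, Pi.smul_apply, smul_eq_mul,
      Submodule.coe_zero, Pi.zero_apply]
    rw [← h1]
    exact Finset.sum_congr rfl fun a _ => mul_comm _ _
  have h2 := Fintype.linearIndependent_iff.1 φ.linearIndependent _ h0
  refine hf (LinearMap.ext fun x => ?_)
  rw [hfx]
  simp [h2]

/-- The coordinate functions of `v` span `V`, by a change of basis of `ℚ^A`. -/
lemma mem_iff_exists_coord [DecidableEq A] (φ : Module.Basis A ℚ V) {U : Matrix A A ℚ}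
    {v : B → A → ℤ} (hU : IsUnit U.det) (hv : ∀ b a, basisMap φ b a = ∑ i, v b i * U i a)
    (f : B → ℚ) : f ∈ V ↔ ∃ s : A → ℚ, ∀ b, f b = ∑ i, s i * v b i := by
  constructor
  · intro hf
    refine ⟨fun i => ∑ a, φ.repr ⟨f, hf⟩ a * U i a, fun b => ?_⟩
    have h1 := congrArg (fun z : V => (z : B → ℚ) b) (φ.sum_repr ⟨f, hf⟩)
    simp only [Submodule.coe_sum, Submodule.coe_smul, Finset.sum_apply, Pi.smul_apply,
      smul_eq_mul] at h1
    rw [← h1]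
    simp only [Finset.sum_mul]
    rw [Finset.sum_comm]
    refine Finset.sum_congr rfl fun a _ => ?_
    have h2 := hv b a
    simp only [basisMap] at h2
    rw [h2, Finset.mul_sum]
    exact Finset.sum_congr rfl fun i _ => by ring
  · rintro ⟨s, hs⟩
    have hvi : ∀ b i, (v b i : ℚ) = ∑ a, U⁻¹ a i * (φ a : B → ℚ) b := by
      intro b i
      have h1 : (fun a => (φ a : B → ℚ) b) = (fun j => (v b j : ℚ)) ᵥ* U := by
        funext a; exact hv b a
      have h2 : (fun a => (φ a : B → ℚ) b) ᵥ* U⁻¹ = fun j => (v b j : ℚ) := by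
        rw [h1, Matrix.vecMul_vecMul, Matrix.mul_nonsing_inv U hU, Matrix.vecMul_one]
      rw [← congrFun h2 i]
      simp only [Matrix.vecMul, dotProduct]
      exact Finset.sum_congr rfl fun a _ => mul_comm _ _
    have hf : f = ∑ i, s i • ∑ a, U⁻¹ a i • (φ a : B → ℚ) := by
      funext b
      rw [hs b]
      simp [hvi]
    rw [hf]
    exact Submodule.sum_mem _ fun i _ => Submodule.smul_mem _ _
      (Submodule.sum_mem _ fun a _ => Submodule.smul_mem _ _ (φ a).2)

/-- The covolume of the lattice is the determinant of its basis. -/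
lemma latticeDet_eq [DecidableEq A] (φ : B → A → ℚ) (U : Matrix A A ℚ) (hU : IsUnit U.det)
    (hlat : lattice φ = Submodule.span ℤ (Set.range fun i => U i)) :
    latticeDet φ = |(U.map (Rat.cast : ℚ → ℝ)).det| := by
  have hdet : (U.map (Rat.cast : ℚ → ℝ)).det = (U.det : ℝ) :=
    ((Rat.castHom ℝ).map_det U).symm
  have hUR : IsUnit (U.map (Rat.cast : ℚ → ℝ)).det := by
    rw [hdet, isUnit_iff_ne_zero]
    exact_mod_cast hU.ne_zero
  have hli : LinearIndependent ℝ (U.map (Rat.cast : ℚ → ℝ)).row :=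
    Matrix.linearIndependent_rows_iff_isUnit.2 ((Matrix.isUnit_iff_isUnit_det _).2 hUR)
  let bR : Module.Basis A ℝ (A → ℝ) := Module.Basis.mk hli
    (hli.span_eq_top_of_card_eq_finrank' (by simp)).ge
  have hbR : ⇑bR = (U.map (Rat.cast : ℚ → ℝ)).row := Module.Basis.coe_mk _ _
  have hreal : realLattice φ = Submodule.span ℤ (Set.range bR) := by
    rw [realLattice, hlat, Submodule.map_span, ← Set.range_comp, hbR]
    rfl
  rw [latticeDet, hreal, ZLattice.covolume_eq_measure_fundamentalDomain _ _
    (ZSpan.isAddFundamentalDomain bR volume), ZSpan.volume_real_fundamentalDomain, hbR]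
  rfl

variable [Fintype B]

/-- The lattice spanned by the `φ b` has a `ℤ`-basis indexed by `A`, the rows of an invertible
matrix `U`; `v b` are the coordinates of `φ b` in this basis. -/
lemma exists_lattice_basis [DecidableEq A] (φ : Module.Basis A ℚ V) :
    ∃ (U : Matrix A A ℚ) (v : B → A → ℤ), IsUnit U.det ∧
      (∀ b a, basisMap φ b a = ∑ i, v b i * U i a) ∧
      lattice (basisMap φ) = Submodule.span ℤ (Set.range fun i => U i) ∧
      ∀ a, ∃ k : B → ℤ, ∀ a', ∑ b, k b * v b a' = if a = a' then 1 else 0 := by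
  have hfin : Module.Finite ℤ (lattice (basisMap φ)) :=
    Module.Finite.span_of_finite ℤ (Set.finite_range _)
  let u₀ := Module.Free.chooseBasis ℤ (lattice (basisMap φ))
  let w : Module.Free.ChooseBasisIndex ℤ (lattice (basisMap φ)) → (A → ℚ) := fun i => (u₀ i : A → ℚ)
  have hli : LinearIndependent ℤ w :=
    u₀.linearIndependent.map' (lattice (basisMap φ)).subtype (Submodule.ker_subtype _)
  have hspan : Submodule.span ℤ (Set.range w) = lattice (basisMap φ) := by
    have h1 : Set.range w = (lattice (basisMap φ)).subtype '' Set.range u₀ := by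
      rw [← Set.range_comp]; rfl
    rw [h1, Submodule.span_image, u₀.span_eq, Submodule.map_top, Submodule.range_subtype]
  have hliQ : LinearIndependent ℚ w := (LinearIndependent.iff_fractionRing ℤ ℚ).1 hli
  have hspanQ : ⊤ ≤ Submodule.span ℚ (Set.range w) := by
    rw [← span_range_basisMap φ, Submodule.span_le]
    rintro _ ⟨b, rfl⟩
    have h1 : basisMap φ b ∈ Submodule.span ℤ (Set.range w) := by
      rw [hspan]; exact Submodule.subset_span ⟨b, rfl⟩
    exact Submodule.span_le_restrictScalars ℤ ℚ _ h1
  let bQ := Module.Basis.mk hliQ hspanQ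
  have hcard : Fintype.card (Module.Free.ChooseBasisIndex ℤ (lattice (basisMap φ)))
      = Fintype.card A := by
    rw [← Module.finrank_eq_card_basis bQ, Module.finrank_fintype_fun_eq_card]
  let e := Fintype.equivOfCardEq hcard
  let U : Matrix A A ℚ := Matrix.of fun i => w (e.symm i)
  have hUrange : Set.range (fun i => U i) = Set.range w := by
    have : (fun i => U i) = w ∘ e.symm := rfl
    rw [this, e.symm.surjective.range_comp]
  have hUli : LinearIndependent ℚ U.row := hliQ.comp _ e.symm.injective
  have hU : IsUnit U.det := (Matrix.isUnit_iff_isUnit_det U).1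
    (Matrix.linearIndependent_rows_iff_isUnit.1 hUli)
  have hlat : lattice (basisMap φ) = Submodule.span ℤ (Set.range fun i => U i) := by
    rw [hUrange, hspan]
  have hmem : ∀ b, ∃ c : A → ℤ, ∑ i, c i • U i = basisMap φ b := fun b => by
    refine (Submodule.mem_span_range_iff_exists_fun ℤ (v := fun i => U i)).1 ?_
    rw [← hlat]
    exact Submodule.subset_span ⟨b, rfl⟩
  choose v hv using hmem
  have hv' : ∀ b a, basisMap φ b a = ∑ i, v b i * U i a := fun b a => by
    rw [← hv b]; simp
  refine ⟨U, v, hU, hv', hlat, fun a => ?_⟩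
  have ha : U a ∈ lattice (basisMap φ) := by
    rw [hlat]; exact Submodule.subset_span ⟨a, rfl⟩
  obtain ⟨k, hk⟩ := (Submodule.mem_span_range_iff_exists_fun ℤ).1 ha
  refine ⟨k, fun a' => ?_⟩
  have hUli' := Fintype.linearIndependent_iff.1 hUli
    (fun i => (∑ b, (k b : ℚ) * v b i) - if a = i then 1 else 0) (by
      simp only [sub_smul, Finset.sum_sub_distrib, ite_smul, one_smul, zero_smul,
        Finset.sum_ite_eq, Finset.mem_univ, if_true]
      rw [sub_eq_zero]
      change _ = U a
      rw [← hk]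
      funext j
      simp only [Finset.sum_apply, Pi.smul_apply]
      simp only [smul_eq_mul, Finset.sum_mul, zsmul_eq_mul, hv', Finset.mul_sum, Matrix.row]
      rw [Finset.sum_comm]
      exact Finset.sum_congr rfl fun b _ => Finset.sum_congr rfl fun i _ => by ring) a'
  have h2 := sub_eq_zero.1 hUli'
  have h3 : ((∑ b, k b * v b a' : ℤ) : ℚ) = ((if a = a' then 1 else 0 : ℤ) : ℚ) := by
    push_cast; exact h2
  exact_mod_cast h3

/-- A function with integer values has integer coordinates, because the vectors `v b` generate
`ℤ^A`. -/
lemma exists_int_coord [DecidableEq A] {v : B → A → ℤ}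
    (hgen : ∀ a, ∃ k : B → ℤ, ∀ a', ∑ b, k b * v b a' = if a = a' then 1 else 0)
    (n : B → ℤ) (s : A → ℚ) (hs : ∀ b, (n b : ℚ) = ∑ i, s i * v b i) :
    ∃ s' : A → ℤ, (∀ i, s i = s' i) ∧ ∀ b, n b = ∑ i, s' i * v b i := by
  choose k hk using hgen
  have h1 : ∀ a, s a = ((∑ b, k a b * n b : ℤ) : ℚ) := by
    intro a
    push_cast
    simp only [hs, Finset.mul_sum]
    rw [Finset.sum_comm]
    have h2 : ∀ i, ∑ b, (k a b : ℚ) * (s i * v b i) = s i * if a = i then 1 else 0 := by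
      intro i
      have h3 : ((∑ b, k a b * v b i : ℤ) : ℚ) = if a = i then 1 else 0 := by
        rw [hk a i]; split_ifs <;> simp
      rw [← h3]
      push_cast
      rw [Finset.mul_sum]
      exact Finset.sum_congr rfl fun b _ => by ring
    simp [h2]
  refine ⟨fun a => ∑ b, k a b * n b, h1, fun b => ?_⟩
  have h4 := hs b
  simp only [h1] at h4
  exact_mod_cast h4

/-- The double orthogonal complement of a rational subspace is the subspace itself. -/
lemma mem_of_forall_orthCompl (V : Submodule ℚ (B → ℚ)) (f : B → ℚ)
    (h : ∀ g ∈ orthCompl V, ∑ b, g b * f b = 0) : f ∈ V := by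
  classical
  by_contra hf
  obtain ⟨F, hF, hker⟩ := Submodule.exists_le_ker_of_notMem hf
  have hFx : ∀ x : B → ℚ, F x = ∑ b, F (Pi.single b 1) * x b := fun x => by
    conv_lhs => rw [← Finset.univ_sum_single x]
    rw [map_sum]
    refine Finset.sum_congr rfl fun a _ => ?_
    rw [mul_comm, ← smul_eq_mul, ← map_smul, ← Pi.single_smul, smul_eq_mul, mul_one]
  refine hF ?_
  rw [hFx]
  refine h (fun b => F (Pi.single b 1)) fun g hg => ?_
  have : F g = 0 := hker hg
  rw [hFx] at this
  rw [← this]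
  exact Finset.sum_congr rfl fun b _ => mul_comm _ _

/-- Under the hypotheses of the local limit theorem, the coordinates of the vectors `φ b` in a basis
of their lattice form an adapted system. -/
lemma isAdapted_of_basis [DecidableEq A] (φ : Module.Basis A ℚ V) {c₂ c₃ : ℕ}
    (h₂ : HasBoundedIntegerBasis ⊤ c₂ V) (h₃ : HasBoundedIntegerBasis 1 c₃ (orthCompl V))
    (hsymm : ∀ b₁ b₂ : B, ∃ π : Equiv.Perm B, IsSymmetry V π ∧ π b₁ = b₂)
    {U : Matrix A A ℚ} {v : B → A → ℤ} (hU : IsUnit U.det)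
    (hv : ∀ b a, basisMap φ b a = ∑ i, v b i * U i a)
    (hgen : ∀ a, ∃ k : B → ℤ, ∀ a', ∑ b, k b * v b a' = if a = a' then 1 else 0) :
    IsAdapted v c₂ c₃ where
  gen := hgen
  bounded := by
    have hfin : Module.Finite ℚ V := Module.Finite.of_basis φ
    obtain ⟨S, hSdef⟩ : ∃ S, S = {f : B → ℚ | f ∈ V ∧ ∃ γ : B → ℤ, (∀ b, f b = (γ b : ℚ)) ∧
      ‖WithLp.toLp ⊤ (fun b => (γ b : ℝ))‖ ≤ c₂} := ⟨_, rfl⟩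
    have hspan : Submodule.span ℚ S = V := by rw [hSdef]; exact h₂
    have hfinS : Module.Finite ℚ (Submodule.span ℚ S) := by rw [hspan]; exact hfin
    obtain ⟨f, hfS, -, hfli⟩ := Submodule.exists_fun_fin_finrank_span_eq ℚ S
    have hcard : Fintype.card A = Fintype.card (Fin (Module.finrank ℚ (Submodule.span ℚ S))) := by
      rw [Fintype.card_fin, hspan, Module.finrank_eq_card_basis φ]
    let e := Fintype.equivOfCardEq hcard
    have hg : ∀ i : A, f (e i) ∈ V ∧ ∃ γ : B → ℤ, (∀ b, f (e i) b = (γ b : ℚ)) ∧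
        ‖WithLp.toLp ⊤ (fun b => (γ b : ℝ))‖ ≤ c₂ := fun i =>
      (Set.ext_iff.1 hSdef _).1 (hfS (e i))
    choose hgV γ hγ hγn using hg
    have hs : ∀ i, ∃ s' : A → ℤ, ∀ b, γ i b = ∑ j, s' j * v b j := fun i => by
      obtain ⟨s, hs⟩ := (mem_iff_exists_coord φ hU hv _).1 (hgV i)
      obtain ⟨s', -, hs'⟩ := exists_int_coord hgen (γ i) s (fun b => by rw [← hγ, hs])
      exact ⟨s', hs'⟩
    choose M hM using hs
    refine ⟨γ, Matrix.of M, fun hdet => ?_, fun i b => ?_, hM⟩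
    · obtain ⟨w, hw, hwM⟩ := Matrix.exists_vecMul_eq_zero_iff.2 hdet
      have hli : LinearIndependent ℚ (fun i : A => f (e i)) := hfli.comp _ e.injective
      have h0 := Fintype.linearIndependent_iff.1 hli (fun i => (w i : ℚ)) (by
        funext b
        simp only [Finset.sum_apply, Pi.smul_apply, smul_eq_mul, Pi.zero_apply, hγ]
        have h1 : ∑ i, w i * γ i b = 0 := by
          simp only [hM, Finset.mul_sum]
          rw [Finset.sum_comm]
          refine Finset.sum_eq_zero fun j _ => ?_
          have h2 := congrFun hwM j
          simp only [Matrix.vecMul, dotProduct, Matrix.of_apply, Pi.zero_apply] at h2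
          calc ∑ i, w i * (M i j * v b j) = (∑ i, w i * M i j) * v b j := by
                rw [Finset.sum_mul]; exact Finset.sum_congr rfl fun i _ => by ring
            _ = 0 := by rw [h2, zero_mul]
        exact_mod_cast h1)
      exact hw (funext fun i => by exact_mod_cast h0 i)
    · have h1 : |(γ i b : ℝ)| ≤ c₂ :=
        (PiLp.norm_apply_le (WithLp.toLp ⊤ (fun b => (γ i b : ℝ))) b).trans (hγn i)
      exact_mod_cast h1
  dual := by
    intro n hn
    have hmem : (fun b => (n b : ℚ)) ∈ V := by
      refine mem_of_forall_orthCompl V _ fun g hg => ?_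
      rw [← h₃] at hg
      induction hg using Submodule.span_induction with
      | mem g hg =>
        obtain ⟨hgV, γ, hγ, hγn⟩ := hg
        have h1 := hn γ (fun a => by
          have hva : (fun b => (v b a : ℚ)) ∈ V :=
            (mem_iff_exists_coord φ hU hv _).2 ⟨Pi.single a 1, fun b => by simp [Pi.single_apply]⟩
          have h2 := hgV _ hva
          simp only [hγ] at h2
          have h3 : ∑ b, v b a * γ b = 0 := by exact_mod_cast h2
          rw [← h3]
          exact Finset.sum_congr rfl fun b _ => mul_comm _ _) (by
          rw [PiLp.norm_eq_of_L1] at hγn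
          simp only [Real.norm_eq_abs] at hγn
          exact_mod_cast hγn)
        simp only [hγ]
        exact_mod_cast h1
      | zero => simp
      | add x y _ _ hx hy => simp [add_mul, Finset.sum_add_distrib, hx, hy]
      | smul c x _ hx => simp [mul_assoc, ← Finset.mul_sum, hx]
    obtain ⟨s, hs⟩ := (mem_iff_exists_coord φ hU hv _).1 hmem
    obtain ⟨s', -, hs'⟩ := exists_int_coord hgen n s hs
    exact ⟨s', hs'⟩
  symm := by
    intro b₁ b₂
    obtain ⟨π, hπ, hπb⟩ := hsymm b₁ b₂
    refine ⟨π, hπb, fun t => ?_⟩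
    have hP : ∀ i, ∃ s : A → ℚ, ∀ b, (v (π b) i : ℚ) = ∑ j, s j * v b j := fun i => by
      have hva : (fun b => (v b i : ℚ)) ∈ V :=
        (mem_iff_exists_coord φ hU hv _).2 ⟨Pi.single i 1, fun b => by simp [Pi.single_apply]⟩
      exact (mem_iff_exists_coord φ hU hv _).1 (hπ _ hva)
    choose P hP using hP
    refine ⟨fun j => ∑ i, t i * P i j, fun b => ?_⟩
    have hP' : ∀ i, (v (π b) i : ℝ) = ∑ j, (P i j : ℝ) * v b j := fun i => by
      have := congrArg (Rat.cast : ℚ → ℝ) (hP i b)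
      push_cast at this
      exact this
    simp only [lin, hP', Finset.mul_sum, Finset.sum_mul]
    rw [Finset.sum_comm]
    exact Finset.sum_congr rfl fun j _ => Finset.sum_congr rfl fun i _ => by ring

end Adapted

end LCLT

namespace LCLT

/-! ### Random subsets -/

section RandomSubset

variable {A B Ω : Type*}

/-- The indicator of the event `b ∈ T`. -/
noncomputable def memIndicator (T : Ω → Finset B) (b : B) : Ω → ℝ :=
  {ω | b ∈ T ω}.indicator fun _ => 1

lemma memIndicator_eq_ite [DecidableEq B] (T : Ω → Finset B) (b : B) (ω : Ω) :
    memIndicator T b ω = if b ∈ T ω then 1 else 0 := by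
  simp [memIndicator, Set.indicator_apply]

lemma eq_iInter_memIndicator [Fintype B] [DecidableEq B] (T : Ω → Finset B) (S : Finset B) :
    {ω | T ω = S} = ⋂ b ∈ (Finset.univ : Finset B),
      memIndicator T b ⁻¹' (if b ∈ S then {1} else {0}) := by
  ext ω
  simp only [Set.mem_ofPred_eq, Finset.mem_univ, Set.iInter_true, Set.mem_iInter, Set.mem_preimage]
  constructor
  · rintro rfl b
    rw [memIndicator_eq_ite]
    split_ifs <;> simp
  · intro h
    ext b
    have := h b
    rw [memIndicator_eq_ite] at this
    by_cases h1 : b ∈ T ω <;> by_cases h2 : b ∈ S <;> simp_all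

lemma randomSum_apply [Fintype B] (φ : B → A → ℚ) (T : Ω → Finset B) (ω : Ω) (a : A) :
    ((randomSum φ T ω a : ℚ) : ℝ) = ∑ b, (φ b a : ℝ) * memIndicator T b ω := by
  classical
  simp only [randomSum, Finset.sum_apply, memIndicator_eq_ite, mul_ite, mul_one, mul_zero,
    Finset.sum_ite_mem, Finset.univ_inter]
  push_cast
  rfl

namespace IsRandomSubset

variable [MeasurableSpace Ω] {P : Measure Ω} {p : ℝ} {T : Ω → Finset B}

lemma iIndepFun_memIndicator (hT : IsRandomSubset P p T) : iIndepFun (memIndicator T) P :=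
  hT.indep.iIndepFun_indicator

lemma measurable_memIndicator (hT : IsRandomSubset P p T) (b : B) : Measurable (memIndicator T b) :=
  measurable_const.indicator (hT.measurableSet_mem b)

lemma integral_memIndicator (hT : IsRandomSubset P p T) (b : B) :
    ∫ ω, memIndicator T b ω ∂P = p := by
  rw [← hT.prob_mem b]
  exact integral_indicator_one (hT.measurableSet_mem b)

lemma measurableSet_eq [Fintype B] (hT : IsRandomSubset P p T) (S : Finset B) :
    MeasurableSet {ω | T ω = S} := by
  classical
  rw [eq_iInter_memIndicator]
  refine MeasurableSet.biInter (Set.to_countable _) fun b _ => hT.measurable_memIndicator b ?_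
  split_ifs <;> exact measurableSet_singleton _

variable [IsProbabilityMeasure P]

lemma memLp_memIndicator (hT : IsRandomSubset P p T) (b : B) : MemLp (memIndicator T b) 2 P :=
  (memLp_const 1).indicator (hT.measurableSet_mem b)

lemma covariance_memIndicator [DecidableEq B] (hT : IsRandomSubset P p T) (b b' : B) :
    cov[memIndicator T b, memIndicator T b'; P] = if b = b' then p * (1 - p) else 0 := by
  split_ifs with h
  · subst h
    rw [covariance_self (hT.measurable_memIndicator b).aemeasurable,
      variance_eq_sub (hT.memLp_memIndicator b)]
    have h2 : memIndicator T b ^ 2 = memIndicator T b := by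
      funext ω
      rw [Pi.pow_apply, memIndicator_eq_ite]
      split_ifs <;> norm_num
    rw [h2, hT.integral_memIndicator]
    ring
  · exact (hT.iIndepFun_memIndicator.indepFun h).covariance_eq_zero (hT.memLp_memIndicator b)
      (hT.memLp_memIndicator b')

variable [Fintype B]

lemma prob_eq [DecidableEq B] (hT : IsRandomSubset P p T) (S : Finset B) :
    P.real {ω | T ω = S} = p ^ S.card * (1 - p) ^ (Sᶜ).card := by
  have h1 := hT.iIndepFun_memIndicator.measure_inter_preimage_eq_mul Finset.univ
    (sets := fun b => if b ∈ S then {1} else {0})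
    (fun b _ => by split_ifs <;> exact measurableSet_singleton _)
  rw [← eq_iInter_memIndicator] at h1
  rw [measureReal_def, h1, ENNReal.toReal_prod]
  have h2 : ∀ b, (P (memIndicator T b ⁻¹' (if b ∈ S then {1} else {0}))).toReal
      = if b ∈ S then p else 1 - p := by
    intro b
    split_ifs with hb
    · rw [← hT.prob_mem b, measureReal_def]
      congr 2
      ext ω
      simp [memIndicator_eq_ite]
    · rw [← hT.prob_mem b, ← probReal_compl_eq_one_sub (hT.measurableSet_mem b), measureReal_def]
      congr 2
      ext ω
      simp [memIndicator_eq_ite]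
  simp only [h2]
  rw [Finset.prod_ite, Finset.prod_const, Finset.prod_const, Finset.filter_mem_eq_inter,
    Finset.univ_inter]
  congr 2
  congr 1
  ext b
  simp

lemma prob_randomSum_eq [Fintype A] [DecidableEq B] (hT : IsRandomSubset P p T) (φ : B → A → ℚ)
    (lam : A → ℚ) : P.real {ω | randomSum φ T ω = lam}
      = ∑ S : Finset B, if ∀ a, ∑ b ∈ S, φ b a = lam a then
          p ^ S.card * (1 - p) ^ (Sᶜ).card else 0 := by
  classical
  have h1 : {ω | randomSum φ T ω = lam} = ⋃ S ∈ Finset.univ.filter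
      (fun S : Finset B => ∀ a, ∑ b ∈ S, φ b a = lam a), {ω | T ω = S} := by
    ext ω
    simp [randomSum, funext_iff]
  rw [h1, measureReal_biUnion_finset, Finset.sum_filter]
  · exact Finset.sum_congr rfl fun S _ => by rw [hT.prob_eq]
  · intro S _ S' _ hne
    refine Set.disjoint_left.2 fun ω h h' => hne ?_
    exact (h : T ω = S).symm.trans h'
  · exact fun S _ => hT.measurableSet_eq S

lemma meanVec_randomSum (hT : IsRandomSubset P p T) (φ : B → A → ℚ) (a : A) :
    meanVec P (randomSum φ T) a = p * ∑ b, (φ b a : ℝ) := by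
  simp only [meanVec, randomSum_apply]
  rw [integral_finsetSum _ fun b _ =>
    ((hT.memLp_memIndicator b).integrable (by norm_num)).const_mul _]
  simp only [integral_const_mul, hT.integral_memIndicator]
  rw [← Finset.sum_mul, mul_comm]

lemma covMatrix_randomSum (hT : IsRandomSubset P p T) (φ : B → A → ℚ) (a a' : A) :
    covMatrix P (randomSum φ T) a a' = p * (1 - p) * ∑ b, (φ b a : ℝ) * φ b a' := by
  classical
  simp only [covMatrix, Matrix.of_apply, randomSum_apply]
  rw [covariance_fun_sum_fun_sum (fun b => (hT.memLp_memIndicator b).const_mul _)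
    (fun b => (hT.memLp_memIndicator b).const_mul _)]
  simp only [covariance_const_mul_left, covariance_const_mul_right, hT.covariance_memIndicator,
    mul_ite, mul_zero, Finset.sum_ite_eq, Finset.mem_univ, if_true]
  rw [Finset.mul_sum]
  exact Finset.sum_congr rfl fun b _ => by ring

end IsRandomSubset

end RandomSubset

/-! ### Change of basis and conclusion -/

section Main

variable {A B : Type*} [Fintype A] [Fintype B] [DecidableEq A]

lemma quadForm_change_basis {S W : Matrix A A ℝ} (hW : IsUnit W.det) (x : A → ℝ) :
    (Wᵀ *ᵥ x) ⬝ᵥ ((Wᵀ * S * W)⁻¹ *ᵥ (Wᵀ *ᵥ x)) = x ⬝ᵥ (S⁻¹ *ᵥ x) := by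
  have hWt : IsUnit Wᵀ.det := by rwa [Matrix.det_transpose]
  rw [Matrix.mul_inv_rev, Matrix.mul_inv_rev, Matrix.mulVec_mulVec, Matrix.mul_assoc,
    Matrix.mul_assoc, Matrix.nonsing_inv_mul _ hWt, Matrix.mul_one, Matrix.mulVec_transpose,
    ← Matrix.dotProduct_mulVec, Matrix.mulVec_mulVec, ← Matrix.mul_assoc, Matrix.mul_nonsing_inv W hW,
    Matrix.one_mul]

lemma gaussNorm_eq {v : B → A → ℤ} {p : ℝ} (h0 : 0 < p) (h1 : p < 1) {W : Matrix A A ℝ}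
    (hW : IsUnit W.det) :
    |W.det| / ((2 * Real.pi) ^ ((Fintype.card A : ℝ) / 2) *
      √(Wᵀ * ((p * (1 - p)) • gram v) * W).det) = gaussNorm v p := by
  have hq : 0 < p * (1 - p) := mul_pos h0 (by linarith)
  have hW0 : 0 < |W.det| := abs_pos.2 hW.ne_zero
  have e1 : (Wᵀ * ((p * (1 - p)) • gram v) * W).det
      = W.det ^ 2 * ((p * (1 - p)) ^ Fintype.card A * (gram v).det) := by
    rw [Matrix.det_mul, Matrix.det_mul, Matrix.det_transpose, Matrix.det_smul]
    ring
  rw [e1, Real.sqrt_mul (sq_nonneg _), Real.sqrt_sq_eq_abs, Real.sqrt_mul (by positivity), gaussNorm]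
  have e2 : √((p * (1 - p)) ^ Fintype.card A) = (p * (1 - p)) ^ ((Fintype.card A : ℝ) / 2) := by
    rw [Real.sqrt_eq_rpow, ← Real.rpow_natCast, ← Real.rpow_mul hq.le]
    congr 1
    ring
  have e3 : (1 / (2 * Real.pi * (p * (1 - p)))) ^ ((Fintype.card A : ℝ) / 2)
      = ((2 * Real.pi) ^ ((Fintype.card A : ℝ) / 2))⁻¹ *
        ((p * (1 - p)) ^ ((Fintype.card A : ℝ) / 2))⁻¹ := by
    rw [one_div, Real.inv_rpow (by positivity), Real.mul_rpow (by positivity) hq.le, mul_inv]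
  rw [e2, e3, ← div_div, ← div_div, ← div_div, div_right_comm _ _ |W.det|, div_self hW0.ne',
    one_div, div_eq_mul_inv _ ((p * (1 - p)) ^ _)]

/-- The error term of the local limit theorem in adapted coordinates; in dimension zero the point
probability is `1`. -/
lemma IsAdapted.exists_error {v : B → A → ℤ} {c₂ c₃ : ℕ} (hv : IsAdapted v c₂ c₃) (hc₂ : 1 ≤ c₂)
    (hc₃ : 1 ≤ c₃) [DecidableEq B] {p : ℝ} (h0 : 0 < p) (h1 : p < 1)
    (hsize : 2 * 10 ^ 8 * c₂ * (c₃ : ℝ) ^ 2 * (Fintype.card A : ℝ) ^ 6 *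
      Real.log (2 * c₃ * Fintype.card A) ^ 6 ≤ min (p * Fintype.card B) ((1 - p) * Fintype.card B))
    (l : A → ℤ) (x : A → ℝ) (hx : ∀ a, x a = l a - p * ∑ b, (v b a : ℝ)) :
    ∃ δ : ℝ, pointProb v p l = gaussNorm v p *
        (Real.exp (-(1 / 2) * (x ⬝ᵥ (((p * (1 - p)) • gram v)⁻¹ *ᵥ x))) + δ) ∧
      |δ| ≤ 2 * 10 ^ 8 * (Fintype.card A : ℝ) ^ 3 *
          Real.log (2 * c₂ * Fintype.card A) ^ (3 / 2 : ℝ) /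
        √(min (p * Fintype.card B) ((1 - p) * Fintype.card B)) := by
  rcases isEmpty_or_nonempty A with hA | hA
  · refine ⟨0, ?_, by simp⟩
    have hl : ∀ S : Finset B, ∑ b ∈ S, v b = l := fun S => Subsingleton.elim _ _
    have h2 : pointProb v p l = 1 := by
      simp only [pointProb, hl, if_true]
      have := Finset.prod_add (fun _ : B => p) (fun _ : B => 1 - p) Finset.univ
      simp only [Finset.prod_const, Finset.powerset_univ, ← Finset.compl_eq_univ_sdiff] at this
      rw [← this]
      simp
    rw [h2]
    simp [gaussNorm]
  · have hp1 : 0 < 1 - p := by linarith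
    have hc₂' : (1 : ℝ) ≤ c₂ := by exact_mod_cast hc₂
    have hc₃' : (1 : ℝ) ≤ c₃ := by exact_mod_cast hc₃
    have hd : 1 ≤ Fintype.card A := Fintype.card_pos
    have hd' : (1 : ℝ) ≤ Fintype.card A := by exact_mod_cast hd
    have hL := log_two_mul_ge hc₃' hd'
    have hl₂ := log_two_mul_ge hc₂' hd'
    have hmin0 : 0 < min (p * Fintype.card B) ((1 - p) * Fintype.card B) :=
      lt_of_lt_of_le (by positivity) hsize
    have hN : (0 : ℝ) < Fintype.card B := by
      have := lt_of_lt_of_le hmin0 (min_le_left _ _)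
      exact pos_of_mul_pos_right this h0.le
    have : Nonempty B := Fintype.card_pos_iff.1 (by exact_mod_cast hN)
    have hmin2 : min (p * Fintype.card B) ((1 - p) * Fintype.card B)
        ≤ 2 * (p * (1 - p) * Fintype.card B) := by
      rcases le_total p (1 / 2) with h | h
      · refine (min_le_left _ _).trans ?_
        nlinarith [mul_pos h0 hN]
      · refine (min_le_right _ _).trans ?_
        nlinarith [mul_pos hp1 hN]
    have hZ := hv.gaussNorm_pos h0 h1
    have hmain := hv.abs_pointProb_sub_le hc₃ h0 h1 l x hx
      (K := 6 * Fintype.card A * Real.log (2 * c₂ * Fintype.card A))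
      (fun J hJ => card_le_of_two_pow_le hc₂ hd hJ) (by positivity)
    have hnum := total_error_le hc₂' hc₃' hd' hmin0 hmin2 hsize
    refine ⟨pointProb v p l / gaussNorm v p -
      Real.exp (-(1 / 2) * (x ⬝ᵥ (((p * (1 - p)) • gram v)⁻¹ *ᵥ x))), ?_, ?_⟩
    · rw [add_sub_cancel, mul_div_cancel₀ _ hZ.ne']
    · refine le_trans ?_ hnum
      rw [← mul_le_mul_iff_right₀ hZ]
      refine le_trans (le_of_eq ?_) hmain
      rw [← abs_of_pos hZ, ← abs_mul, abs_of_pos hZ, mul_sub, mul_div_cancel₀ _ hZ.ne']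

end Main

end LCLT

theorem theorem4p1 :
    ∃ C : ℝ, 0 < C ∧
      ∀ (B A : Type*) [Fintype B] [Fintype A] [DecidableEq A]
        (V : Submodule ℚ (B → ℚ)) (φ : Module.Basis A ℚ V)
        (c₂ c₃ : ℕ) (_ : 1 ≤ c₂) (_ : 1 ≤ c₃)
        (_ : LCLT.HasBoundedIntegerBasis ⊤ c₂ V)
        (_ : LCLT.HasBoundedIntegerBasis 1 c₃ (LCLT.orthCompl V))
        (_ : ∀ b₁ b₂ : B, ∃ π : Equiv.Perm B, LCLT.IsSymmetry V π ∧ π b₁ = b₂)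
        (p : ℝ) (_ : 0 < p) (_ : p < 1)
        (_ : C * c₂ * (c₃ : ℝ) ^ 2 * (Module.finrank ℚ V : ℝ) ^ 6 *
            Real.log (2 * c₃ * Module.finrank ℚ V) ^ 6
          ≤ min (p * Fintype.card B) ((1 - p) * Fintype.card B))
        (Ω : Type*) [MeasurableSpace Ω] (P : Measure Ω) [IsProbabilityMeasure P]
        (T : Ω → Finset B) (_ : LCLT.IsRandomSubset P p T)
        (X : Ω → A → ℚ) (_ : X = LCLT.randomSum (LCLT.basisMap φ) T)
        (lam : A → ℚ) (_ : lam ∈ LCLT.lattice (LCLT.basisMap φ)),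
        ∃ δ : ℝ,
          P.real {ω | X ω = lam} =
            LCLT.latticeDet (LCLT.basisMap φ) /
                ((2 * Real.pi) ^ ((Module.finrank ℚ V : ℝ) / 2) *
                  √(LCLT.covMatrix P X).det) *
              (Real.exp (-(1 / 2) *
                  ((LCLT.toRealVec lam - LCLT.meanVec P X) ⬝ᵥ
                    ((LCLT.covMatrix P X)⁻¹ *ᵥ (LCLT.toRealVec lam - LCLT.meanVec P X)))) + δ) ∧
          |δ| ≤ C * (Module.finrank ℚ V : ℝ) ^ 3 *
              Real.log (2 * c₂ * Module.finrank ℚ V) ^ (3 / 2 : ℝ) /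
            √(min (p * Fintype.card B) ((1 - p) * Fintype.card B)) := by
  refine ⟨2 * 10 ^ 8, by norm_num, ?_⟩
  intro B A _ _ _ V φ c₂ c₃ hc₂ hc₃ h₂ h₃ hsymm p h0 h1 hsize Ω _ P _ T hT X hX lam hlam
  classical
  rw [Module.finrank_eq_card_basis φ] at hsize ⊢
  obtain ⟨U, v, hU, hv, hlat, hgen⟩ := LCLT.exists_lattice_basis φ
  have hadapt := LCLT.isAdapted_of_basis φ h₂ h₃ hsymm hU hv hgen
  let W : Matrix A A ℝ := U.map (Rat.cast : ℚ → ℝ)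
  have hW : IsUnit W.det := by
    have hdet : W.det = (U.det : ℝ) := ((Rat.castHom ℝ).map_det U).symm
    rw [hdet, isUnit_iff_ne_zero]
    exact_mod_cast hU.ne_zero
  have hvR : ∀ b a, (LCLT.basisMap φ b a : ℝ) = ∑ i, (v b i : ℝ) * W i a := fun b a => by
    rw [hv b a]; push_cast; rfl
  rw [hlat] at hlam
  obtain ⟨l, hl⟩ := (Submodule.mem_span_range_iff_exists_fun ℤ).1 hlam
  have hl' : ∀ a, lam a = ∑ i, l i * U i a := fun a => by rw [← hl]; simp
  let x : A → ℝ := fun a => l a - p * ∑ b, (v b a : ℝ)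
  -- The mean and the covariance transform under the change of basis `W`.
  have hcov : LCLT.covMatrix P X = Wᵀ * ((p * (1 - p)) • LCLT.gram v) * W := by
    ext a a'
    rw [hX, hT.covMatrix_randomSum, Matrix.mul_smul, Matrix.smul_mul, Matrix.smul_apply, smul_eq_mul]
    congr 1
    simp only [hvR, Matrix.mul_apply, Matrix.transpose_apply, LCLT.gram, Matrix.of_apply,
      Finset.sum_mul, Finset.mul_sum]
    rw [Finset.sum_comm]
    refine Finset.sum_congr rfl fun i _ => ?_
    rw [Finset.sum_comm]
    exact Finset.sum_congr rfl fun j _ => Finset.sum_congr rfl fun b _ => by ring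
  have hmean : LCLT.toRealVec lam - LCLT.meanVec P X = Wᵀ *ᵥ x := by
    funext a
    rw [hX, Pi.sub_apply, hT.meanVec_randomSum]
    simp only [LCLT.toRealVec, hl', hvR, Matrix.mulVec, dotProduct, Matrix.transpose_apply, x,
      mul_sub, Finset.sum_sub_distrib]
    push_cast
    congr 1
    · exact Finset.sum_congr rfl fun i _ => mul_comm _ _
    · rw [Finset.sum_comm, Finset.mul_sum]
      refine Finset.sum_congr rfl fun i _ => ?_
      rw [← Finset.sum_mul]
      ring
  have hprob : P.real {ω | X ω = lam} = LCLT.pointProb v p l := by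
    rw [hX, hT.prob_randomSum_eq, LCLT.pointProb]
    refine Finset.sum_congr rfl fun S _ => if_congr ?_ rfl rfl
    have hli : LinearIndependent ℚ U.row :=
      Matrix.linearIndependent_rows_iff_isUnit.2 ((Matrix.isUnit_iff_isUnit_det U).2 hU)
    constructor
    · intro h
      funext i
      have h2 := Fintype.linearIndependent_iff.1 hli
        (fun i => ((∑ b ∈ S, v b i - l i : ℤ) : ℚ)) (by
          funext a
          have h3 := h a
          simp only [hv, hl'] at h3
          rw [Finset.sum_comm] at h3
          simp only [Finset.sum_apply, Pi.smul_apply, smul_eq_mul, Matrix.row, Pi.zero_apply]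
          push_cast
          simp only [sub_mul, Finset.sum_sub_distrib, Finset.sum_mul]
          rw [h3, sub_self]) i
      have h4 : ∑ b ∈ S, v b i - l i = 0 := by exact_mod_cast h2
      rw [Finset.sum_apply]
      omega
    · rintro rfl a
      simp only [hv, hl', Finset.sum_apply]
      rw [Finset.sum_comm]
      push_cast
      simp only [Finset.sum_mul]
  obtain ⟨δ, hδ, hδ'⟩ := hadapt.exists_error hc₂ hc₃ h0 h1 hsize l x fun _ => rfl
  refine ⟨δ, ?_, hδ'⟩
  rw [hprob, hδ, hcov, hmean, LCLT.quadForm_change_basis hW, LCLT.latticeDet_eq _ U hU hlat,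
    LCLT.gaussNorm_eq h0 h1 hW]
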